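/- **Lemma 6.1.** Let $G$ be a second countable, locally compact, Hausdorff, étale groupoid with unit space $G^{(0)}$, range map $r$ and source map $s$ (étale: $G$ is a topological groupoid and $s:G\to G^{(0)}$ is a local homeomorphism). For an étale, locally compact, Hausdorff groupoid $H$, let $C_c(H)$ be the $*$-algebra of compactly supported continuous functions $H\to\mathbb{C}$ with $$f*g(\gamma)=\sum_{r(\eta)=r(\gamma)}f(\eta)\,g(\eta^{-1}\gamma),\qquad f^*(\gamma)=\overline{f(\gamma^{-1})},$$ and put $\|f\|_I=\sup_{u\in H^{(0)}}\max\{\sum_{s(\gamma)=u}|f(\gamma)|,\ \sum_{r(\gamma)=u}|f(\gamma)|\}$. Then $C^*(H)$ is the completion of $C_c(H)$ in the norm $\|f\|=\sup\{\|\pi(f)\|\}$, where $\pi$ runs over the $*$-representations of $C_c(H)$ on Hilbert spaces with $\|\pi(g)\|\le\|g\|_I$ for all $g\in C_c(H)$, and $C^*_r(H)$ is the completion of $C_c(H)$ in the norm $\|f\|_r=\sup_{u\in H^{(0)}}\|\pi_u(f)\|$, where $\pi_u$ is the regular representation on $\ell^2(s^{-1}(u))$, $\pi_u(f)\delta_\gamma=\sum_{s(\eta)=r(\gamma)}f(\eta)\delta_{\eta\gamma}$.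 We write $C^*(H)=C^*_r(H)$ if the canonical quotient map $C^*(H)\to C^*_r(H)$ (the continuous extension of the identity of $C_c(H)$) is an isomorphism. A set $D\subseteq G^{(0)}$ is invariant if $r(\gamma)\in D$ whenever $s(\gamma)\in D$, and for such $D$ we put $G|_D=\{\gamma\in G: r(\gamma),s(\gamma)\in D\}$, with the subspace topology. Suppose that $C^*(G)=C^*_r(G)$. Then the following are equivalent: 1. For every closed invariant set $D\subseteq G^{(0)}$, $C^*(G|_D)=C^*_r(G|_D)$. 2. For every closed invariant set $D\subseteq G^{(0)}$, the sequence $$0\longrightarrow C^*_r(G|_{G^{(0)}-D})\xrightarrow{\ \iota_r\ }C^*_r(G)\xrightarrow{\ \rho_r\ }C^*_r(G|_D)\longrightarrow 0$$ is exact, where $\iota_r$ and $\rho_r$ are the $*$-homomorphisms determined on compactly supported continuous functions by extension by zero and by restriction, respectively. -/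

import Mathlib

namespace GroupoidCStar

open Topology Set
open scoped ENNReal CompactlySupported

set_option linter.unusedVariables false
set_option linter.unusedSectionVars false

universe u

/-- A groupoid on the set of arrows `G`: a small category in which every morphism is invertible,
with its objects identified with the identity arrows. `src a` and `rng a` are the identity arrows
at the source and at the range of `a`, and `comp a b` is the product `ab`, defined when
`s(a) = r(b)`. -/
class ArrowGroupoid (G : Type u) where
  src : G → G
  rng : G → G
  comp : ∀ a b : G, src a = rng b → G
  inv : G → G
  src_src : ∀ a, src (src a) = src a
  rng_src : ∀ a, rng (src a) = src a
  src_rng : ∀ a, src (rng a) = rng a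
  rng_rng : ∀ a, rng (rng a) = rng a
  src_comp : ∀ a b h, src (comp a b h) = src b
  rng_comp : ∀ a b h, rng (comp a b h) = rng a
  comp_assoc : ∀ a b c (h : src a = rng b) (k : src b = rng c),
    comp (comp a b h) c ((src_comp a b h).trans k) =
      comp a (comp b c k) (h.trans (rng_comp b c k).symm)
  comp_src : ∀ a, comp a (src a) (rng_src a).symm = a
  rng_comp_self : ∀ a, comp (rng a) a (src_rng a) = a
  src_inv : ∀ a, src (inv a) = rng a
  rng_inv : ∀ a, rng (inv a) = src a
  inv_comp : ∀ a, comp (inv a) a (src_inv a) = src a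
  comp_inv : ∀ a, comp a (inv a) (rng_inv a).symm = rng a

open ArrowGroupoid

attribute [simp] src_src rng_src src_rng rng_rng src_comp rng_comp comp_src rng_comp_self
  src_inv rng_inv inv_comp comp_inv

section Algebra

variable {G : Type u} [ArrowGroupoid G]

variable (G) in
/-- The unit space `G⁽⁰⁾`: the set of identity arrows, with the subspace topology. -/
abbrev UnitSpace : Type u := {x : G // src x = x}

/-- The source map `s : G → G⁽⁰⁾`. -/
def sourceMap (a : G) : UnitSpace G := ⟨src a, src_src a⟩

/-- The range map `r : G → G⁽⁰⁾`. -/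
def rangeMap (a : G) : UnitSpace G := ⟨rng a, src_rng a⟩

lemma comp_congr {a a' b b' : G} (ha : a = a') (hb : b = b') (h : src a = rng b) :
    comp a b h = comp a' b' (ha ▸ hb ▸ h) := by subst ha hb; rfl

lemma rng_unit (x : UnitSpace G) : rng x.1 = x.1 := by
  rw [← x.2, rng_src]

@[simp] lemma source_unit (x : UnitSpace G) : sourceMap x.1 = x := Subtype.ext x.2

@[simp] lemma range_unit (x : UnitSpace G) : rangeMap x.1 = x := Subtype.ext (rng_unit x)

lemma inv_comp_cancel (a b : G) (h : src a = rng b) :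
    comp (inv a) (comp a b h) (by simp) = b := by
  rw [← comp_assoc (inv a) a b (by simp) h, comp_congr (inv_comp a) rfl, comp_congr h rfl]
  simp

lemma comp_inv_cancel (a b : G) (h : rng a = rng b) :
    comp a (comp (inv a) b (by simp [h])) (by simp) = b := by
  rw [← comp_assoc a (inv a) b (by simp) (by simp [h]), comp_congr (comp_inv a) rfl,
    comp_congr h rfl]
  simp

lemma comp_cancel_inv (a b : G) (h : src a = rng b) :
    comp (comp a b h) (inv b) (by simp) = a := by
  rw [comp_assoc a b (inv b) h (by simp), comp_congr rfl (comp_inv b), comp_congr rfl h.symm]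
  simp

lemma inv_cancel_comp (a b : G) (h : src a = src b) :
    comp (comp a (inv b) (by simp [h])) b (by simp) = a := by
  rw [comp_assoc a (inv b) b (by simp [h]) (by simp), comp_congr rfl (inv_comp b),
    comp_congr rfl h.symm]
  simp

lemma comp_right_inj {a a' b : G} (h : src a = rng b) (h' : src a' = rng b)
    (e : comp a b h = comp a' b h') : a = a' := by
  rw [← comp_cancel_inv a b h, ← comp_cancel_inv a' b h', comp_congr e rfl]

lemma comp_left_inj {a b b' : G} (h : src a = rng b) (h' : src a = rng b')
    (e : comp a b h = comp a b' h') : b = b' := by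
  rw [← inv_comp_cancel a b h, ← inv_comp_cancel a b' h', comp_congr rfl e]

@[simp] lemma inv_inv_arrow (a : G) : inv (inv a) = a :=
  comp_right_inj (b := inv a) (by simp) (by simp) (by simp)

lemma inv_comp_rev (a b : G) (h : src a = rng b) :
    inv (comp a b h) = comp (inv b) (inv a) (by simp [h]) := by
  refine comp_right_inj (b := comp a b h) (by simp) (by simp) ?_
  rw [inv_comp, comp_assoc _ _ _ _ (by simp), comp_congr rfl (inv_comp_cancel a b h)]
  simp

end Algebra

section Topological

variable {G : Type u} [TopologicalSpace G] [ArrowGroupoid G]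

/-- An étale groupoid: a topological groupoid (composition is continuous on the composable pairs,
inversion is a homeomorphism, being continuous and involutive) whose source map `s : G → G⁽⁰⁾` is
a local homeomorphism. -/
class EtaleGroupoid (G : Type u) [TopologicalSpace G] [ArrowGroupoid G] : Prop where
  continuous_comp :
    Continuous fun p : {p : G × G // src p.1 = rng p.2} => comp p.1.1 p.1.2 p.2
  continuous_inv : Continuous (inv : G → G)
  isLocalHomeomorph_source : IsLocalHomeomorph (sourceMap : G → UnitSpace G)

open EtaleGroupoid

variable [EtaleGroupoid G]

lemma continuous_source : Continuous (sourceMap : G → UnitSpace G) :=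
  isLocalHomeomorph_source.continuous

/-- Inversion as a homeomorphism. -/
def invHomeo : G ≃ₜ G where
  toFun := inv
  invFun := inv
  left_inv := inv_inv_arrow
  right_inv := inv_inv_arrow
  continuous_toFun := continuous_inv
  continuous_invFun := continuous_inv

lemma isLocalHomeomorph_range : IsLocalHomeomorph (rangeMap : G → UnitSpace G) := by
  have h : (rangeMap : G → UnitSpace G) = sourceMap ∘ (invHomeo : G ≃ₜ G) := by
    funext a; exact Subtype.ext (src_inv a).symm
  rw [h]
  exact isLocalHomeomorph_source.comp invHomeo.isLocalHomeomorph

lemma continuous_range : Continuous (rangeMap : G → UnitSpace G) := isLocalHomeomorph_range.continuous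

lemma continuous_src : Continuous (src : G → G) := continuous_subtype_val.comp continuous_source

lemma continuous_rng : Continuous (rng : G → G) := continuous_subtype_val.comp continuous_range

end Topological

section FiberSums

variable {E X : Type*} [TopologicalSpace E] [TopologicalSpace X]

/-- Local description of the fibres of a local homeomorphism inside a compact set. -/
lemma exists_local_sections [T2Space E] [T2Space X] {p : E → X} (hp : IsLocalHomeomorph p)
    {K : Set E} (hK : IsCompact K) (x : X) :
    ∃ (F : Finset E) (W : Set X) (σ : F → W → E), IsOpen W ∧ x ∈ W ∧
      (∀ e, Continuous (σ e)) ∧ (∀ e w, p (σ e w) = w) ∧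
      (∀ w, Function.Injective fun e => σ e w) ∧
      ∀ w : W, ∀ k ∈ K, p k = w → ∃ e, σ e w = k := by
  classical
  have hfin : (K ∩ p ⁻¹' {x}).Finite := by
    have hc : IsCompact (K ∩ p ⁻¹' {x}) :=
      hK.inter_right (isClosed_singleton.preimage hp.continuous)
    refine hc.finite (isDiscrete_iff_forall_mem_exists_isOpen.2 ?_)
    intro k hk
    obtain ⟨V, hV, hkV, hinj⟩ := hp.isLocallyInjective k
    refine ⟨V, hV, ?_⟩
    ext y
    constructor
    · rintro ⟨hy, hy2⟩
      exact hinj hy hkV (hy2.2.trans hk.2.symm)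
    · rintro rfl
      exact ⟨hkV, hk⟩
  obtain ⟨V, hV, hdisj⟩ := hfin.t2_separation
  choose e he hpe using hp
  let F : Finset E := hfin.toFinset
  let B : E → Set E := fun k => (e k).source ∩ V k
  have hBo : ∀ k, IsOpen (B k) := fun k => (e k).open_source.inter (hV k).2
  have hp' : IsLocalHomeomorph p := fun k => ⟨e k, he k, hpe k⟩
  let C : Set E := K \ ⋃ k ∈ F, B k
  have hC : IsCompact C := hK.diff (isOpen_biUnion fun k _ => hBo k)
  let W : Set X := (p '' C)ᶜ ∩ ⋂ k ∈ F, p '' (B k)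
  have hWo : IsOpen W := (hC.image hp'.continuous).isClosed.isOpen_compl.inter
    (isOpen_biInter_finset fun k _ => hp'.isOpenMap _ (hBo k))
  have hsec : ∀ k ∈ F, ∀ w ∈ W, (e k).symm w ∈ B k ∧ p ((e k).symm w) = w := by
    intro k hk w hw
    obtain ⟨b, hb, rfl⟩ := mem_iInter₂.1 hw.2 k hk
    have : (e k).symm (p b) = b := by
      rw [congrFun (hpe k) b]; exact (e k).left_inv hb.1
    rw [this]; exact ⟨hb, rfl⟩
  refine ⟨F, W, fun k w => (e k.1).symm w, hWo, ⟨?_, ?_⟩, ?_, ?_, ?_, ?_⟩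
  · rintro ⟨k, hk, hkx⟩
    refine hk.2 (mem_iUnion₂.2 ⟨k, ?_, he k, (hV k).1⟩)
    exact hfin.mem_toFinset.2 ⟨hk.1, hkx⟩
  · refine mem_iInter₂.2 fun k hk => ⟨k, ⟨he k, (hV k).1⟩, ?_⟩
    exact (hfin.mem_toFinset.1 hk).2
  · intro k
    refine ((e k.1).continuousOn_symm).comp_continuous continuous_subtype_val ?_
    intro w
    obtain ⟨b, hb, hbw⟩ := mem_iInter₂.1 w.2.2 k.1 k.2
    rw [← hbw, congrFun (hpe k) b]
    exact (e k.1).map_source hb.1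
  · intro k w; exact (hsec k.1 k.2 w w.2).2
  · intro w k l hkl
    by_contra hne
    have h1 := (hsec k.1 k.2 w w.2).1.2
    have h2 := (hsec l.1 l.2 w w.2).1.2
    have hkl' : (e k.1).symm w = (e l.1).symm w := hkl
    rw [hkl'] at h1
    exact Set.disjoint_left.1 (hdisj (hfin.mem_toFinset.1 k.2) (hfin.mem_toFinset.1 l.2)
      (fun h => hne (Subtype.ext h))) h1 h2
  · intro w k hk hkw
    have : k ∈ ⋃ l ∈ F, B l := by
      by_contra hcon
      exact w.2.1 ⟨k, ⟨hk, hcon⟩, hkw⟩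
    obtain ⟨l, hl, hkl⟩ := mem_iUnion₂.1 this
    refine ⟨⟨l, hl⟩, ?_⟩
    change (e l).symm w = k
    rw [← hkw, congrFun (hpe l) k]; exact (e l).left_inv hkl.1

/-- Sums along the fibres of a local homeomorphism, of functions supported in a compact set,
are continuous. -/
lemma continuous_fiberSum [T2Space E] [T2Space X] {p : E → X} (hp : IsLocalHomeomorph p)
    {K : Set E} (hK : IsCompact K) {Z M : Type*} [TopologicalSpace Z] [TopologicalSpace M]
    [AddCommMonoid M] [ContinuousAdd M] [T2Space M] {q : Z → X} (hq : Continuous q)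
    (h : {y : Z × E // p y.2 = q y.1} → M) (hh : Continuous h) (h0 : ∀ y, y.1.2 ∉ K → h y = 0) :
    Continuous fun z => ∑' e : {e : E // p e = q z}, h ⟨(z, e.1), e.2⟩ := by
  classical
  rw [continuous_iff_continuousAt]
  intro z
  obtain ⟨F, W, σ, hW, hzW, hσ, hpσ, hinj, hcov⟩ := exists_local_sections hp hK (q z)
  have key : ∀ y : q ⁻¹' W, ∑' e : {e : E // p e = q y.1}, h ⟨(y.1, e.1), e.2⟩ =
      ∑ k : F, h ⟨(y.1, σ k ⟨q y.1, y.2⟩), hpσ k _⟩ := by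
    intro y
    let τ : F → {e : E // p e = q y.1} := fun k => ⟨σ k ⟨q y.1, y.2⟩, hpσ k _⟩
    have hτ : Function.Injective τ := fun k l hkl => hinj _ (congrArg Subtype.val hkl)
    rw [← hτ.tsum_eq (f := fun e : {e : E // p e = q y.1} => h ⟨(y.1, e.1), e.2⟩), tsum_fintype]
    intro e he
    by_cases heK : e.1 ∈ K
    · obtain ⟨k, hk⟩ := hcov ⟨q y.1, y.2⟩ e.1 heK e.2
      exact ⟨k, Subtype.ext hk⟩
    · exact absurd (h0 ⟨(y.1, e.1), e.2⟩ heK) he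
  have hcont : ContinuousOn (fun z => ∑' e : {e : E // p e = q z}, h ⟨(z, e.1), e.2⟩)
      (q ⁻¹' W) := by
    rw [continuousOn_iff_continuous_domRestrict]
    have : (q ⁻¹' W).domRestrict (fun z => ∑' e : {e : E // p e = q z}, h ⟨(z, e.1), e.2⟩) =
        fun y : q ⁻¹' W => ∑ k : F, h ⟨(y.1, σ k ⟨q y.1, y.2⟩), hpσ k _⟩ := funext key
    rw [this]
    refine continuous_finsetSum _ fun k _ => hh.comp ?_
    refine Continuous.subtype_mk (continuous_subtype_val.prodMk ((hσ k).comp ?_)) _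
    exact Continuous.subtype_mk (hq.comp continuous_subtype_val) _
  exact hcont.continuousAt ((hW.preimage hq).mem_nhds hzW)

/-- A compact set meets each fibre of a local homeomorphism in a finite set. -/
lemma finite_fiber [T2Space E] [T2Space X] {p : E → X} (hp : IsLocalHomeomorph p)
    {K : Set E} (hK : IsCompact K) (x : X) : (K ∩ p ⁻¹' {x}).Finite := by
  obtain ⟨F, W, σ, -, hxW, -, -, -, hcov⟩ := exists_local_sections hp hK x
  refine (Set.finite_range fun k => σ k ⟨x, hxW⟩).subset ?_
  rintro k ⟨hk, hkx⟩
  exact hcov ⟨x, hxW⟩ k hk hkx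

end FiberSums

section SchurTest

variable {I : Type*} (k : I → I → ℂ) (C : ℝ≥0∞)

lemma enorm_sq_tsum (ξ : lp (fun _ : I => ℂ) 2) :
    ∑' i, ‖ξ i‖ₑ ^ (2 : ℝ) = ‖ξ‖ₑ ^ (2 : ℝ) := by
  have h := lp.hasSum_norm (p := 2) (by norm_num) ξ
  simp only [ENNReal.toReal_ofNat] at h
  have h2 : ∀ x : ℝ, 0 ≤ x → ENNReal.ofReal x ^ (2 : ℝ) = ENNReal.ofReal (x ^ (2 : ℝ)) :=
    fun x hx => ENNReal.ofReal_rpow_of_nonneg hx (by norm_num)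
  simp only [← ofReal_norm]
  rw [h2 _ (norm_nonneg _), ← h.tsum_eq, ENNReal.ofReal_tsum_of_nonneg (fun i => by positivity)
    h.summable]
  exact tsum_congr fun i => h2 _ (norm_nonneg _)

lemma schur_row (a b : I → ℝ≥0∞) :
    (∑' j, a j * b j) ^ (2 : ℝ) ≤ (∑' j, a j) * ∑' j, a j * b j ^ (2 : ℝ) := by
  have key : ∑' j, a j * b j ≤
      ((∑' j, a j) * ∑' j, a j * b j ^ (2 : ℝ)) ^ (1 / 2 : ℝ) := by
    rw [ENNReal.tsum_eq_iSup_sum]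
    refine iSup_le fun s => (ENNReal.inner_le_weight_mul_Lp_of_nonneg s one_le_two a b).trans ?_
    rw [ENNReal.mul_rpow_of_nonneg _ _ (by norm_num)]
    norm_num
    gcongr
    · exact ENNReal.sum_le_tsum s
    · exact ENNReal.sum_le_tsum s
  calc (∑' j, a j * b j) ^ (2 : ℝ)
      ≤ (((∑' j, a j) * ∑' j, a j * b j ^ (2 : ℝ)) ^ (1 / 2 : ℝ)) ^ (2 : ℝ) := by gcongr
    _ = _ := by rw [← ENNReal.rpow_mul]; norm_num

variable {k C}

lemma schur_sum (hr : ∀ i, ∑' j, ‖k i j‖ₑ ≤ C) (hc : ∀ j, ∑' i, ‖k i j‖ₑ ≤ C)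
    (ξ : lp (fun _ : I => ℂ) 2) :
    ∑' i, (∑' j, ‖k i j‖ₑ * ‖ξ j‖ₑ) ^ (2 : ℝ) ≤ (C * ‖ξ‖ₑ) ^ (2 : ℝ) := by
  calc ∑' i, (∑' j, ‖k i j‖ₑ * ‖ξ j‖ₑ) ^ (2 : ℝ)
      ≤ ∑' i, C * ∑' j, ‖k i j‖ₑ * ‖ξ j‖ₑ ^ (2 : ℝ) :=
        ENNReal.tsum_le_tsum fun i => (schur_row _ _).trans (by gcongr; exact hr i)
    _ = C * ∑' j, (∑' i, ‖k i j‖ₑ) * ‖ξ j‖ₑ ^ (2 : ℝ) := by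
        rw [ENNReal.tsum_mul_left, ENNReal.tsum_comm]
        simp_rw [ENNReal.tsum_mul_right]
    _ ≤ C * ∑' j, C * ‖ξ j‖ₑ ^ (2 : ℝ) := by gcongr with j; exact hc j
    _ = (C * ‖ξ‖ₑ) ^ (2 : ℝ) := by
        rw [ENNReal.tsum_mul_left, enorm_sq_tsum, ENNReal.mul_rpow_of_nonneg _ _ (by norm_num),
          ← mul_assoc]
        congr 1
        rw [ENNReal.rpow_two, sq]

lemma schur_summable (hC : C ≠ ⊤) (hr : ∀ i, ∑' j, ‖k i j‖ₑ ≤ C)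
    (hc : ∀ j, ∑' i, ‖k i j‖ₑ ≤ C) (ξ : lp (fun _ : I => ℂ) 2) (i : I) :
    Summable fun j => k i j * ξ j := by
  have h1 : (∑' j, ‖k i j‖ₑ * ‖ξ j‖ₑ) ^ (2 : ℝ) ≠ ⊤ := by
    refine ne_top_of_le_ne_top ?_ ((ENNReal.le_tsum i).trans (schur_sum hr hc ξ))
    exact ENNReal.rpow_ne_top_of_nonneg (by norm_num) (ENNReal.mul_ne_top hC enorm_ne_top)
  have h2 : ∑' j, ‖k i j * ξ j‖ₑ ≠ ⊤ := by
    simp_rw [enorm_mul]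
    intro h
    rw [h] at h1
    exact h1 (ENNReal.top_rpow_of_pos (by norm_num))
  refine Summable.of_norm ?_
  have h3 := ENNReal.summable_toReal h2
  simpa using h3

lemma schur_enorm_le (hr : ∀ i, ∑' j, ‖k i j‖ₑ ≤ C)
    (hc : ∀ j, ∑' i, ‖k i j‖ₑ ≤ C) (ξ : lp (fun _ : I => ℂ) 2) :
    ∑' i, ‖∑' j, k i j * ξ j‖ₑ ^ (2 : ℝ) ≤ (C * ‖ξ‖ₑ) ^ (2 : ℝ) := by
  refine (ENNReal.tsum_le_tsum fun i => ?_).trans (schur_sum hr hc ξ)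
  gcongr
  simp_rw [← enorm_mul]
  exact enorm_tsum_le_tsum_enorm

/-- The linear map on `ℓ²` given by a kernel with uniformly bounded row and column sums. -/
noncomputable def kernelLinearMap (k : I → I → ℂ) (C : ℝ≥0∞) (hC : C ≠ ⊤)
    (hr : ∀ i, ∑' j, ‖k i j‖ₑ ≤ C) (hc : ∀ j, ∑' i, ‖k i j‖ₑ ≤ C) :
    lp (fun _ : I => ℂ) 2 →ₗ[ℂ] lp (fun _ : I => ℂ) 2 where
  toFun ξ := ⟨fun i => ∑' j, k i j * ξ j, by
    refine memℓp_gen ?_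
    have h : ∑' i, ‖∑' j, k i j * ξ j‖ₑ ^ (2 : ℝ) ≠ ⊤ :=
      ne_top_of_le_ne_top (ENNReal.rpow_ne_top_of_nonneg (by norm_num)
        (ENNReal.mul_ne_top hC enorm_ne_top)) (schur_enorm_le hr hc ξ)
    simpa [← ENNReal.toReal_rpow] using ENNReal.summable_toReal h⟩
  map_add' ξ η := by
    ext i
    simp only [lp.coeFn_add, Pi.add_apply, mul_add]
    exact (schur_summable hC hr hc ξ i).tsum_add (schur_summable hC hr hc η i)
  map_smul' c ξ := by
    ext i
    simp only [lp.coeFn_smul, Pi.smul_apply, smul_eq_mul, RingHom.id_apply, ← tsum_mul_left]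
    exact tsum_congr fun j => by ring

/-- The bounded operator on `ℓ²` given by a kernel with uniformly bounded row and column sums
(the Schur test). -/
noncomputable def kernelOperator (k : I → I → ℂ) (C : ℝ≥0∞) (hC : C ≠ ⊤)
    (hr : ∀ i, ∑' j, ‖k i j‖ₑ ≤ C) (hc : ∀ j, ∑' i, ‖k i j‖ₑ ≤ C) :
    lp (fun _ : I => ℂ) 2 →L[ℂ] lp (fun _ : I => ℂ) 2 :=
  (kernelLinearMap k C hC hr hc).mkContinuous C.toReal fun ξ => by
    have h : ‖kernelLinearMap k C hC hr hc ξ‖ₑ ^ (2 : ℝ) ≤ (C * ‖ξ‖ₑ) ^ (2 : ℝ) := by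
      rw [← enorm_sq_tsum]
      exact schur_enorm_le hr hc ξ
    rw [ENNReal.rpow_le_rpow_iff (by norm_num)] at h
    simpa using ENNReal.toReal_mono (ENNReal.mul_ne_top hC enorm_ne_top) h

lemma kernelOperator_apply (hC : C ≠ ⊤) (hr : ∀ i, ∑' j, ‖k i j‖ₑ ≤ C)
    (hc : ∀ j, ∑' i, ‖k i j‖ₑ ≤ C) (ξ : lp (fun _ : I => ℂ) 2) (i : I) :
    kernelOperator k C hC hr hc ξ i = ∑' j, k i j * ξ j := rfl

lemma kernelOperator_single [DecidableEq I] (hC : C ≠ ⊤) (hr : ∀ i, ∑' j, ‖k i j‖ₑ ≤ C)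
    (hc : ∀ j, ∑' i, ‖k i j‖ₑ ≤ C) (i j : I) :
    kernelOperator k C hC hr hc (lp.single 2 j 1) i = k i j := by
  rw [kernelOperator_apply, tsum_eq_single j]
  · simp
  · intro l hl; simp [Pi.single_eq_of_ne hl]

lemma kernelOperator_norm_le (hC : C ≠ ⊤) (hr : ∀ i, ∑' j, ‖k i j‖ₑ ≤ C)
    (hc : ∀ j, ∑' i, ‖k i j‖ₑ ≤ C) : ‖kernelOperator k C hC hr hc‖ ≤ C.toReal :=
  LinearMap.mkContinuous_norm_le _ ENNReal.toReal_nonneg _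

lemma operator_ext [DecidableEq I] {S T : lp (fun _ : I => ℂ) 2 →L[ℂ] lp (fun _ : I => ℂ) 2}
    (h : ∀ i j, S (lp.single 2 j 1) i = T (lp.single 2 j 1) i) : S = T := by
  refine lp.ext_continuousLinearMap (by norm_num) fun j => ?_
  ext i
  simpa using h i j

end SchurTest

section Convolution

open EtaleGroupoid

variable (G : Type u) [TopologicalSpace G]

/-- `C_c(G)`, a type synonym carrying the convolution product. -/
def Cc : Type u := C_c(G, ℂ)

noncomputable instance : AddCommGroup (Cc G) := inferInstanceAs (AddCommGroup C_c(G, ℂ))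

noncomputable instance : Module ℂ (Cc G) := inferInstanceAs (Module ℂ C_c(G, ℂ))

instance : FunLike (Cc G) G ℂ := inferInstanceAs (FunLike C_c(G, ℂ) G ℂ)

variable {G}

namespace Cc

/-- Build an element of `C_c(G)`. -/
def mk (f : G → ℂ) (hf : Continuous f) (hs : HasCompactSupport f) : Cc G :=
  (⟨⟨f, hf⟩, hs⟩ : C_c(G, ℂ))

@[simp] lemma mk_apply (f : G → ℂ) (hf : Continuous f) (hs : HasCompactSupport f) (γ : G) :
    mk f hf hs γ = f γ := rfl

@[ext] lemma ext {f g : Cc G} (h : ∀ γ, f γ = g γ) : f = g := DFunLike.ext f g h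

lemma continuous (f : Cc G) : Continuous f := (f : C_c(G, ℂ)).continuous_toFun

lemma hasCompactSupport (f : Cc G) : HasCompactSupport f := (f : C_c(G, ℂ)).hasCompactSupport'

@[simp] lemma zero_apply (γ : G) : (0 : Cc G) γ = 0 := rfl

@[simp] lemma add_apply (f g : Cc G) (γ : G) : (f + g) γ = f γ + g γ := rfl

@[simp] lemma smul_apply (c : ℂ) (f : Cc G) (γ : G) : (c • f) γ = c * f γ := rfl

lemma eq_zero_of_notMem (f : Cc G) {γ : G} (h : γ ∉ tsupport f) : f γ = 0 :=
  image_eq_zero_of_notMem_tsupport h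

end Cc

variable [ArrowGroupoid G]

/-- The convolution `(f * g)(γ) = ∑_{r(η) = r(γ)} f(η) g(η⁻¹γ)`. -/
noncomputable def convolution (f g : G → ℂ) (γ : G) : ℂ :=
  ∑' η : {η : G // rangeMap η = rangeMap γ},
    f η.1 * g (comp (inv η.1) γ ((src_inv η.1).trans (congrArg Subtype.val η.2)))

/-- The `I`-norm `‖f‖_I = sup_u max (∑_{γ ∈ Gu} |f(γ)|, ∑_{γ ∈ uG} |f(γ)|)`, as an extended
nonnegative real. -/
noncomputable def normI (f : Cc G) : ℝ≥0∞ :=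
  ⨆ u : UnitSpace G, max (∑' γ : {γ : G // sourceMap γ = u}, ‖f γ.1‖ₑ)
    (∑' γ : {γ : G // rangeMap γ = u}, ‖f γ.1‖ₑ)

variable [EtaleGroupoid G] [T2Space G]

lemma continuous_convolution (f g : Cc G) : Continuous (convolution f g) := by
  refine continuous_fiberSum (p := (rangeMap : G → UnitSpace G)) (q := rangeMap) isLocalHomeomorph_range
    f.hasCompactSupport.isCompact continuous_range
    (fun y => f y.1.2 * g (comp (inv y.1.2) y.1.1
      ((src_inv y.1.2).trans (congrArg Subtype.val y.2)))) ?_ ?_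
  · refine (f.continuous.comp (continuous_snd.comp continuous_subtype_val)).mul
      (g.continuous.comp ?_)
    refine continuous_comp.comp (Continuous.subtype_mk
      ((EtaleGroupoid.continuous_inv.comp (continuous_snd.comp continuous_subtype_val)).prodMk
        (continuous_fst.comp continuous_subtype_val))
      fun y => (src_inv y.1.2).trans (congrArg Subtype.val y.2))
  · intro y hy
    rw [f.eq_zero_of_notMem hy, zero_mul]

lemma hasCompactSupport_convolution (f g : Cc G) : HasCompactSupport (convolution f g) := by
  have hcl : IsClosed {p : G × G | src p.1 = rng p.2} :=
    isClosed_eq (continuous_src.comp continuous_fst) (continuous_rng.comp continuous_snd)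
  have hK : IsCompact ((Subtype.val : {p : G × G // src p.1 = rng p.2} → G × G) ⁻¹'
      (tsupport f ×ˢ tsupport g)) :=
    hcl.isClosedEmbedding_subtypeVal.isCompact_preimage
      (f.hasCompactSupport.isCompact.prod g.hasCompactSupport.isCompact)
  refine HasCompactSupport.intro (hK.image continuous_comp) fun γ hγ => ?_
  refine (tsum_congr fun η => ?_).trans tsum_zero
  by_contra hne
  have hηγ : rng η.1 = rng γ := congrArg Subtype.val η.2
  refine hγ ⟨⟨(η.1, comp (inv η.1) γ ((src_inv η.1).trans hηγ)), by simp⟩, ⟨?_, ?_⟩, ?_⟩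
  · exact subset_tsupport _ (left_ne_zero_of_mul hne)
  · exact subset_tsupport _ (right_ne_zero_of_mul hne)
  · exact comp_inv_cancel η.1 γ hηγ

/-- The product of `C_c(G)` is convolution. -/
noncomputable instance : Mul (Cc G) where
  mul f g := Cc.mk (convolution f g) (continuous_convolution f g)
    (hasCompactSupport_convolution f g)

/-- The involution `f^*(γ) = conj (f(γ⁻¹))`. -/
noncomputable instance : Star (Cc G) where
  star f := Cc.mk (fun γ => star (f (inv γ)))
    (continuous_star.comp (f.continuous.comp EtaleGroupoid.continuous_inv))
    ((f.hasCompactSupport.comp_homeomorph invHomeo).comp_left (star_zero ℂ))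

lemma Cc.mul_apply (f g : Cc G) (γ : G) : (f * g) γ = convolution f g γ := rfl

@[simp] lemma Cc.star_apply (f : Cc G) (γ : G) : (star f) γ = star (f (inv γ)) := rfl

lemma fiberSum_enorm_bounded {p : G → UnitSpace G} (hp : IsLocalHomeomorph p) (f : Cc G) :
    ∃ C : ℝ≥0∞, C ≠ ⊤ ∧ ∀ u, ∑' γ : {γ : G // p γ = u}, ‖f γ.1‖ₑ ≤ C := by
  have hc : Continuous fun u : UnitSpace G => ∑' γ : {γ : G // p γ = u}, ‖f γ.1‖ₑ :=
    continuous_fiberSum (q := id) hp f.hasCompactSupport.isCompact continuous_id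
      (fun y => ‖f y.1.2‖ₑ)
      (f.continuous.comp (continuous_snd.comp continuous_subtype_val)).enorm
      (fun y hy => by rw [f.eq_zero_of_notMem hy, enorm_zero])
  have hfin : ∀ u, ∑' γ : {γ : G // p γ = u}, ‖f γ.1‖ₑ ≠ ⊤ := by
    intro u
    have hF := finite_fiber hp f.hasCompactSupport.isCompact u
    have hF' : (Subtype.val ⁻¹' (tsupport f ∩ p ⁻¹' {u}) : Set {γ : G // p γ = u}).Finite :=
      hF.preimage Subtype.val_injective.injOn
    rw [tsum_eq_sum (s := hF'.toFinset)]
    · exact ENNReal.sum_ne_top.2 fun _ _ => enorm_ne_top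
    · intro γ hγ
      rw [f.eq_zero_of_notMem, enorm_zero]
      intro h
      exact hγ (hF'.mem_toFinset.2 ⟨h, γ.2⟩)
  obtain hem | hne := (p '' tsupport f).eq_empty_or_nonempty
  · refine ⟨0, by simp, fun u => ?_⟩
    simp only [nonpos_iff_eq_zero, ENNReal.tsum_eq_zero]
    intro γ
    rw [f.eq_zero_of_notMem, enorm_zero]
    rw [image_eq_empty] at hem
    simp [hem]
  · obtain ⟨v, -, hv⟩ := (f.hasCompactSupport.isCompact.image hp.continuous).exists_isMaxOn hne
      hc.continuousOn
    refine ⟨_, hfin v, fun u => ?_⟩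
    by_cases hu : u ∈ p '' tsupport f
    · exact hv hu
    · refine le_of_eq_of_le (ENNReal.tsum_eq_zero.2 fun γ => ?_) zero_le
      rw [f.eq_zero_of_notMem, enorm_zero]
      intro h
      exact hu ⟨γ.1, h, γ.2⟩

lemma normI_ne_top (f : Cc G) : normI f ≠ ⊤ := by
  obtain ⟨C, hC, h⟩ := fiberSum_enorm_bounded isLocalHomeomorph_source f
  obtain ⟨C', hC', h'⟩ := fiberSum_enorm_bounded isLocalHomeomorph_range f
  exact ne_top_of_le_ne_top (max_lt hC.lt_top hC'.lt_top).ne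
    (iSup_le fun u => max_le_max (h u) (h' u))

end Convolution

section Quotients

variable {G : Type u} [ArrowGroupoid G]

lemma composable_inv {u : UnitSpace G} (γ ζ : {γ : G // sourceMap γ = u}) :
    src γ.1 = rng (inv ζ.1) :=
  (congrArg Subtype.val (γ.2.trans ζ.2.symm)).trans (rng_inv ζ.1).symm

/-- `γ ζ⁻¹` for `γ, ζ ∈ Gu`. -/
def divArrow {u : UnitSpace G} (γ ζ : {γ : G // sourceMap γ = u}) : G :=
  comp γ.1 (inv ζ.1) (composable_inv γ ζ)

lemma range_quot {u : UnitSpace G} (γ ζ : {γ : G // sourceMap γ = u}) :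
    rangeMap (divArrow γ ζ) = rangeMap γ.1 := Subtype.ext (rng_comp _ _ _)

lemma source_quot {u : UnitSpace G} (γ ζ : {γ : G // sourceMap γ = u}) :
    sourceMap (divArrow γ ζ) = rangeMap ζ.1 := Subtype.ext ((src_comp _ _ _).trans (src_inv _))

lemma inv_quot {u : UnitSpace G} (γ ζ : {γ : G // sourceMap γ = u}) :
    inv (divArrow γ ζ) = divArrow ζ γ := by
  unfold divArrow
  rw [inv_comp_rev, comp_congr (inv_inv_arrow _) rfl]

lemma inv_quot_comp_quot {u : UnitSpace G} (γ κ ζ : {γ : G // sourceMap γ = u})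
    (h : src (inv (divArrow γ κ)) = rng (divArrow γ ζ)) :
    comp (inv (divArrow γ κ)) (divArrow γ ζ) h = divArrow κ ζ := by
  rw [comp_congr (inv_quot γ κ) rfl]
  unfold divArrow
  rw [comp_assoc _ _ _ (composable_inv κ γ) (by simp),
    comp_congr rfl (inv_comp_cancel γ.1 (inv ζ.1) (composable_inv γ ζ))]

/-- For fixed `γ ∈ Gu`, the map `ζ ↦ γζ⁻¹` is a bijection from `Gu` to the arrows with
the same range as `γ`. -/
noncomputable def quotEquiv {u : UnitSpace G} (γ : {γ : G // sourceMap γ = u}) :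
    {γ : G // sourceMap γ = u} ≃ {η : G // rangeMap η = rangeMap γ.1} where
  toFun ζ := ⟨divArrow γ ζ, range_quot γ ζ⟩
  invFun η := ⟨comp (inv η.1) γ.1 ((src_inv η.1).trans (congrArg Subtype.val η.2)),
    (Subtype.ext (src_comp _ _ _)).trans γ.2⟩
  left_inv ζ := Subtype.ext <| by
    simp only [divArrow]
    rw [comp_congr (inv_comp_rev _ _ _) rfl, comp_congr (comp_congr (inv_inv_arrow _) rfl _) rfl]
    exact inv_cancel_comp _ _ (congrArg Subtype.val (ζ.2.trans γ.2.symm))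
  right_inv η := Subtype.ext <| by
    simp only [divArrow]
    rw [comp_congr rfl (inv_comp_rev _ _ _), comp_congr rfl (comp_congr rfl (inv_inv_arrow _) _)]
    exact comp_inv_cancel _ _ (congrArg Subtype.val η.2).symm

lemma quot_left_injective {u : UnitSpace G} (ζ : {γ : G // sourceMap γ = u}) :
    Function.Injective fun γ : {γ : G // sourceMap γ = u} => divArrow γ ζ := fun γ γ' h =>
  Subtype.ext (comp_right_inj _ _ h)

end Quotients

section RegularRepresentation

variable {G : Type u} [TopologicalSpace G] [ArrowGroupoid G]

/-- The Hilbert space `ℓ²(Gu)`. -/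
abbrev FiberSpace (u : UnitSpace G) : Type u := lp (fun _ : {γ : G // sourceMap γ = u} => ℂ) 2

lemma row_le (f : Cc G) {u : UnitSpace G} (γ : {γ : G // sourceMap γ = u}) :
    ∑' ζ, ‖f (divArrow γ ζ)‖ₑ ≤ normI f := by
  refine ((quotEquiv γ).tsum_eq (fun η => ‖f η.1‖ₑ)).le.trans ?_
  exact (le_max_right _ _).trans
    (le_iSup (fun u : UnitSpace G => max (∑' γ : {γ : G // sourceMap γ = u}, ‖f γ.1‖ₑ)
      (∑' γ : {γ : G // rangeMap γ = u}, ‖f γ.1‖ₑ)) (rangeMap γ.1))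

lemma column_le (f : Cc G) {u : UnitSpace G} (ζ : {γ : G // sourceMap γ = u}) :
    ∑' γ, ‖f (divArrow γ ζ)‖ₑ ≤ normI f := by
  have hinj : Function.Injective fun γ : {γ : G // sourceMap γ = u} =>
      (⟨divArrow γ ζ, source_quot γ ζ⟩ : {η : G // sourceMap η = rangeMap ζ.1}) := fun γ γ' h =>
    quot_left_injective ζ (congrArg Subtype.val h)
  refine (ENNReal.tsum_comp_le_tsum_of_injective hinj (fun η => ‖f η.1‖ₑ)).trans ?_
  exact (le_max_left _ _).trans
    (le_iSup (fun u : UnitSpace G => max (∑' γ : {γ : G // sourceMap γ = u}, ‖f γ.1‖ₑ)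
      (∑' γ : {γ : G // rangeMap γ = u}, ‖f γ.1‖ₑ)) (rangeMap ζ.1))

variable [EtaleGroupoid G] [T2Space G]

/-- The regular representation `π_u` on `ℓ²(Gu)`: the operator with
`π_u(f) δ_ζ = ∑_{s(η) = r(ζ)} f(η) δ_{ηζ}`, that is, with matrix entries `f(γζ⁻¹)`. -/
noncomputable def regularOperator (u : UnitSpace G) (f : Cc G) : FiberSpace u →L[ℂ] FiberSpace u :=
  kernelOperator (fun γ ζ => f (divArrow γ ζ)) (normI f) (normI_ne_top f) (row_le f) (column_le f)

lemma regularOperator_apply (u : UnitSpace G) (f : Cc G) (ξ : FiberSpace u)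
    (γ : {γ : G // sourceMap γ = u}) :
    regularOperator u f ξ γ = ∑' ζ, f (divArrow γ ζ) * ξ ζ := rfl

open Classical in
lemma regularOperator_single (u : UnitSpace G) (f : Cc G) (γ ζ : {γ : G // sourceMap γ = u}) :
    regularOperator u f (lp.single 2 ζ 1) γ = f (divArrow γ ζ) :=
  kernelOperator_single _ _ _ _ _

lemma regularOperator_norm_le (u : UnitSpace G) (f : Cc G) :
    ‖regularOperator u f‖ ≤ (normI f).toReal := kernelOperator_norm_le _ _ _

lemma regularOperator_mul (u : UnitSpace G) (f g : Cc G) :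
    regularOperator u (f * g) = regularOperator u f * regularOperator u g := by
  classical
  refine operator_ext fun γ ζ => ?_
  rw [regularOperator_single, mul_apply_eq_comp, regularOperator_apply]
  simp_rw [regularOperator_single]
  rw [Cc.mul_apply, convolution]
  have hr : rangeMap (divArrow γ ζ) = rangeMap γ.1 := range_quot γ ζ
  let e : {γ : G // sourceMap γ = u} ≃ {η : G // rangeMap η = rangeMap (divArrow γ ζ)} :=
    (quotEquiv γ).trans (Equiv.subtypeEquivRight fun η => by rw [hr])
  rw [← e.tsum_eq]
  refine tsum_congr fun κ => ?_
  change f (divArrow γ κ) * g (comp (inv (divArrow γ κ)) (divArrow γ ζ) _) = _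
  congr 2
  exact inv_quot_comp_quot γ κ ζ _

lemma regularOperator_star (u : UnitSpace G) (f : Cc G) :
    regularOperator u (star f) = star (regularOperator u f) := by
  classical
  refine operator_ext fun γ ζ => ?_
  have h : ∀ (ξ : FiberSpace u) (γ : {γ : G // sourceMap γ = u}),
      ξ γ = inner ℂ (lp.single 2 γ (1 : ℂ) : FiberSpace u) ξ := by
    intro ξ γ
    rw [lp.inner_single_left]; simp
  rw [regularOperator_single, h (star (regularOperator u f) _), ContinuousLinearMap.star_eq_adjoint,
    ContinuousLinearMap.adjoint_inner_right, ← inner_conj_symm, ← h, regularOperator_single,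
    Cc.star_apply, inv_quot]
  rfl

lemma regularOperator_add (u : UnitSpace G) (f g : Cc G) :
    regularOperator u (f + g) = regularOperator u f + regularOperator u g := by
  classical
  refine operator_ext fun γ ζ => ?_
  simp only [_root_.add_apply, lp.coeFn_add, Pi.add_apply, regularOperator_single,
    Cc.add_apply]

lemma regularOperator_smul (u : UnitSpace G) (c : ℂ) (f : Cc G) :
    regularOperator u (c • f) = c • regularOperator u f := by
  classical
  refine operator_ext fun γ ζ => ?_
  simp only [_root_.smul_apply, lp.coeFn_smul, Pi.smul_apply, regularOperator_single,
    Cc.smul_apply, smul_eq_mul]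

lemma regularOperator_injective {f g : Cc G}
    (h : ∀ u, regularOperator u f = regularOperator u g) : f = g := by
  classical
  ext γ
  have := regularOperator_single (sourceMap γ) f ⟨γ, rfl⟩ ⟨src γ, Subtype.ext (src_src γ)⟩
  rw [h, regularOperator_single] at this
  have hq : divArrow (⟨γ, rfl⟩ : {η : G // sourceMap η = sourceMap γ})
      ⟨src γ, Subtype.ext (src_src γ)⟩ = γ := by
    have := inv_cancel_comp γ (src γ) (by simp)
    unfold divArrow
    rw [← comp_src (comp γ (inv (src γ)) (by simp))] 
    exact (comp_congr rfl (by simp) _).trans this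
  rw [hq] at this
  exact this.symm

noncomputable instance : NonUnitalRing (Cc G) where
  left_distrib f g h := regularOperator_injective fun u => by
    simp only [regularOperator_mul, regularOperator_add, mul_add]
  right_distrib f g h := regularOperator_injective fun u => by
    simp only [regularOperator_mul, regularOperator_add, add_mul]
  zero_mul f := by
    have h : ∀ u : UnitSpace G, regularOperator u 0 = 0 := fun u => by
      have := regularOperator_smul u 0 (0 : Cc G)
      rwa [zero_smul, zero_smul] at this
    exact regularOperator_injective fun u => by rw [regularOperator_mul, h, zero_mul]
  mul_zero f := by
    have h : ∀ u : UnitSpace G, regularOperator u 0 = 0 := fun u => by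
      have := regularOperator_smul u 0 (0 : Cc G)
      rwa [zero_smul, zero_smul] at this
    exact regularOperator_injective fun u => by rw [regularOperator_mul, h, mul_zero]
  mul_assoc f g h := regularOperator_injective fun u => by
    simp only [regularOperator_mul, mul_assoc]

noncomputable instance : StarRing (Cc G) where
  star_involutive f := by ext γ; simp
  star_mul f g := regularOperator_injective fun u => by
    simp only [regularOperator_mul, regularOperator_star, star_mul]
  star_add f g := by ext γ; simp

instance : StarModule ℂ (Cc G) where
  star_smul c f := by ext γ; simp

instance : IsScalarTower ℂ (Cc G) (Cc G) where
  smul_assoc c f g := regularOperator_injective fun u => by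
    simp only [smul_eq_mul, regularOperator_mul, regularOperator_smul, smul_mul_assoc]

instance : SMulCommClass ℂ (Cc G) (Cc G) where
  smul_comm c f g := regularOperator_injective fun u => by
    simp only [smul_eq_mul, regularOperator_mul, regularOperator_smul, mul_smul_comm]

/-- The regular representation `π_u` of the `*`-algebra `C_c(G)` on `ℓ²(Gu)`. -/
noncomputable def regularRep (u : UnitSpace G) :
    Cc G →⋆ₙₐ[ℂ] (FiberSpace u →L[ℂ] FiberSpace u) where
  toFun := regularOperator u
  map_smul' c f := regularOperator_smul u c f
  map_zero' := by
    have := regularOperator_smul u 0 (0 : Cc G)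
    rwa [zero_smul, zero_smul] at this
  map_add' := regularOperator_add u
  map_mul' := regularOperator_mul u
  map_star' := regularOperator_star u

end RegularRepresentation

section ClosureRange

variable {A B C : Type*} [NonUnitalRing A] [StarRing A] [Module ℂ A] [IsScalarTower ℂ A A]
  [SMulCommClass ℂ A A] [StarModule ℂ A] [NonUnitalCStarAlgebra B] [NonUnitalCStarAlgebra C]

/-- The closure of the range of a `*`-homomorphism, i.e. the completion of `A` in the
seminorm `a ↦ ‖φ a‖`. -/
def closureRange (φ : A →⋆ₙₐ[ℂ] B) : NonUnitalStarSubalgebra ℂ B :=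
  (NonUnitalStarAlgHom.range φ).topologicalClosure

instance (φ : A →⋆ₙₐ[ℂ] B) : IsClosed (closureRange φ : Set B) :=
  NonUnitalStarSubalgebra.isClosed_topologicalClosure _

/-- The canonical map from `A` to its completion. -/
def toClosureRange (φ : A →⋆ₙₐ[ℂ] B) : A →⋆ₙₐ[ℂ] closureRange φ :=
  NonUnitalStarAlgHom.codRestrict φ (closureRange φ) fun a =>
    NonUnitalStarSubalgebra.le_topologicalClosure _ (NonUnitalStarAlgHom.mem_range_self φ a)

@[simp] lemma coe_toClosureRange (φ : A →⋆ₙₐ[ℂ] B) (a : A) : (toClosureRange φ a : B) = φ a := rfl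

lemma norm_toClosureRange (φ : A →⋆ₙₐ[ℂ] B) (a : A) : ‖toClosureRange φ a‖ = ‖φ a‖ := rfl

lemma denseRange_toClosureRange (φ : A →⋆ₙₐ[ℂ] B) : DenseRange (toClosureRange φ) := by
  intro x
  rw [closure_subtype]
  have hx : (x : B) ∈ closure (Set.range φ) := by
    have := x.2
    rwa [← NonUnitalStarAlgHom.coe_range]
  convert hx using 1
  congr 1
  ext b
  constructor
  · rintro ⟨_, ⟨a, rfl⟩, rfl⟩; exact ⟨a, rfl⟩
  · rintro ⟨a, rfl⟩; exact ⟨_, ⟨a, rfl⟩, rfl⟩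

/-- The unique continuous extension to completions of a `*`-homomorphism that does not increase
the seminorms. -/
noncomputable def extendHom (φ : A →⋆ₙₐ[ℂ] B) (ψ : A →⋆ₙₐ[ℂ] C) (h : ∀ a, ‖ψ a‖ ≤ ‖φ a‖) :
    closureRange φ →⋆ₙₐ[ℂ] C :=
  let e : A →ₗ[ℂ] closureRange φ := (toClosureRange φ : A →ₗ[ℂ] closureRange φ)
  let f : A →ₗ[ℂ] C := (ψ : A →ₗ[ℂ] C)
  have hd : DenseRange e := denseRange_toClosureRange φ
  have he : ∀ a, f.extendOfNorm e (e a) = f a := fun a =>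
    LinearMap.extendOfNorm_eq hd ⟨1, fun a => (h a).trans_eq (one_mul _).symm⟩ a
  { toFun := f.extendOfNorm e
    map_smul' := fun c x => map_smul _ c x
    map_zero' := map_zero _
    map_add' := map_add _
    map_mul' := fun x y => by
      refine hd.induction_on₂ (p := fun x y => f.extendOfNorm e (x * y) =
        f.extendOfNorm e x * f.extendOfNorm e y)
        (isClosed_eq (by fun_prop) (by fun_prop)) (fun a b => ?_) x y
      have : e a * e b = e (a * b) := (map_mul (toClosureRange φ) a b).symm
      rw [this, he, he, he]
      exact map_mul ψ a b
    map_star' := fun x => by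
      refine hd.induction_on (p := fun x => f.extendOfNorm e (star x) =
        star (f.extendOfNorm e x)) x (isClosed_eq (by fun_prop) (by fun_prop)) (fun a => ?_)
      have : star (e a) = e (star a) := (map_star (toClosureRange φ) a).symm
      rw [this, he, he]
      exact map_star ψ a }

lemma extendHom_apply (φ : A →⋆ₙₐ[ℂ] B) (ψ : A →⋆ₙₐ[ℂ] C) (h : ∀ a, ‖ψ a‖ ≤ ‖φ a‖) (a : A) :
    extendHom φ ψ h (toClosureRange φ a) = ψ a :=
  LinearMap.extendOfNorm_eq (e := (toClosureRange φ : A →ₗ[ℂ] closureRange φ))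
    (f := (ψ : A →ₗ[ℂ] C)) (denseRange_toClosureRange φ)
    ⟨1, fun a => (h a).trans_eq (one_mul _).symm⟩ a

/-- The `ℓ^∞`-product of a family of `C*`-algebras. -/
def BoundedProduct {I : Type*} (D : I → Type*) [∀ i, NonUnitalCStarAlgebra (D i)] : Type _ :=
  lp D ∞

noncomputable instance {I : Type*} (D : I → Type*) [∀ i, NonUnitalCStarAlgebra (D i)] :
    NonUnitalCStarAlgebra (BoundedProduct D) := inferInstanceAs (NonUnitalCStarAlgebra (lp D ∞))

/-- The direct sum of a pointwise bounded family of `*`-homomorphisms. -/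
noncomputable def directSumHom {I : Type*} {D : I → Type*} [∀ i, NonUnitalCStarAlgebra (D i)]
    (π : ∀ i, A →⋆ₙₐ[ℂ] D i) (b : A → ℝ) (hb : ∀ i a, ‖π i a‖ ≤ b a) :
    A →⋆ₙₐ[ℂ] BoundedProduct D where
  toFun a := (⟨fun i => π i a, memℓp_infty ⟨b a, by rintro _ ⟨i, rfl⟩; exact hb i a⟩⟩ : lp D ∞)
  map_smul' c a := lp.ext (funext fun i => map_smul (π i) c a)
  map_zero' := lp.ext (funext fun i => map_zero (π i))
  map_add' a a' := lp.ext (funext fun i => map_add (π i) a a')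
  map_mul' a a' := lp.ext (funext fun i => map_mul (π i) a a')
  map_star' a := lp.ext (funext fun i => map_star (π i) a)

lemma norm_directSumHom {I : Type*} {D : I → Type*} [∀ i, NonUnitalCStarAlgebra (D i)]
    (π : ∀ i, A →⋆ₙₐ[ℂ] D i) (b : A → ℝ) (hb : ∀ i a, ‖π i a‖ ≤ b a) (a : A) :
    ‖directSumHom π b hb a‖ = ⨆ i, ‖π i a‖ := rfl

lemma norm_directSumHom_le {I : Type*} {D : I → Type*} [∀ i, NonUnitalCStarAlgebra (D i)]
    (π : ∀ i, A →⋆ₙₐ[ℂ] D i) (b : A → ℝ) (hb : ∀ i a, ‖π i a‖ ≤ b a) (a : A) {r : ℝ}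
    (hr : 0 ≤ r) (h : ∀ i, ‖π i a‖ ≤ r) : ‖directSumHom π b hb a‖ ≤ r :=
  Real.iSup_le h hr

lemma le_norm_directSumHom {I : Type*} {D : I → Type*} [∀ i, NonUnitalCStarAlgebra (D i)]
    (π : ∀ i, A →⋆ₙₐ[ℂ] D i) (b : A → ℝ) (hb : ∀ i a, ‖π i a‖ ≤ b a) (a : A) (i : I) :
    ‖π i a‖ ≤ ‖directSumHom π b hb a‖ :=
  le_ciSup (f := fun i => ‖π i a‖) ⟨b a, by rintro _ ⟨i, rfl⟩; exact hb i a⟩ i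

end ClosureRange

section CStarAlgebras

variable (G : Type u) [TopologicalSpace G] [ArrowGroupoid G] [EtaleGroupoid G] [T2Space G]

/-- An `I`-norm decreasing representation of `C_c(G)` on a Hilbert space. Since `C_c(G)` lives in
`Type u`, so does every cyclic representation up to unitary equivalence, and Hilbert spaces in
`Type u` are enough to compute the norm of `C*(G)`. -/
structure Representation where
  H : Type u
  [normedAddCommGroup : NormedAddCommGroup H]
  [innerProductSpace : InnerProductSpace ℂ H]
  [completeSpace : CompleteSpace H]
  toHom : Cc G →⋆ₙₐ[ℂ] (H →L[ℂ] H)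
  enorm_le : ∀ f, ‖toHom f‖ₑ ≤ normI f

attribute [instance] Representation.normedAddCommGroup Representation.innerProductSpace
  Representation.completeSpace

variable {G}

lemma Representation.norm_le (π : Representation G) (f : Cc G) :
    ‖π.toHom f‖ ≤ (normI f).toReal := by
  simpa using ENNReal.toReal_mono (normI_ne_top f) (π.enorm_le f)

variable (G)

/-- The regular representation as an `I`-norm decreasing representation. -/
noncomputable def regularRepresentation (u : UnitSpace G) : Representation G where
  H := FiberSpace u
  toHom := regularRep u
  enorm_le f := by
    rw [← ofReal_norm, ← ENNReal.ofReal_toReal (normI_ne_top f)]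
    exact ENNReal.ofReal_le_ofReal (regularOperator_norm_le u f)

/-- The direct sum of all `I`-norm decreasing representations. -/
noncomputable def fullRep :
    Cc G →⋆ₙₐ[ℂ] BoundedProduct fun π : Representation G => (π.H →L[ℂ] π.H) :=
  directSumHom (fun π => π.toHom) (fun f => (normI f).toReal) fun π f => π.norm_le f

/-- The direct sum of the regular representations. -/
noncomputable def reducedRep :
    Cc G →⋆ₙₐ[ℂ] BoundedProduct fun u : UnitSpace G => (FiberSpace u →L[ℂ] FiberSpace u) :=
  directSumHom (fun u => regularRep u) (fun f => (normI f).toReal)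
    fun u f => regularOperator_norm_le u f

/-- The norm of `C*(G)` on `C_c(G)`. -/
lemma norm_fullRep (f : Cc G) : ‖fullRep G f‖ = ⨆ π : Representation G, ‖π.toHom f‖ := rfl

/-- The norm of `C*_r(G)` on `C_c(G)`. -/
lemma norm_reducedRep (f : Cc G) : ‖reducedRep G f‖ = ⨆ u : UnitSpace G, ‖regularRep u f‖ := rfl

/-- `C*(G)`: the completion of `C_c(G)` in the norm
`‖f‖ = sup {‖π(f)‖ : π an I-norm decreasing representation}`. -/
def FullCStar : Type (u + 1) := closureRange (fullRep G)

noncomputable instance : NonUnitalCStarAlgebra (FullCStar G) :=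
  inferInstanceAs (NonUnitalCStarAlgebra (closureRange (fullRep G)))

/-- `C*_r(G)`: the completion of `C_c(G)` in the norm `‖f‖_r = sup {‖π_u(f)‖ : u ∈ G⁽⁰⁾}`. -/
def ReducedCStar : Type u := closureRange (reducedRep G)

noncomputable instance : NonUnitalCStarAlgebra (ReducedCStar G) :=
  inferInstanceAs (NonUnitalCStarAlgebra (closureRange (reducedRep G)))

/-- The canonical map `C_c(G) → C*(G)`. -/
noncomputable def toFull : Cc G →⋆ₙₐ[ℂ] FullCStar G := toClosureRange (fullRep G)

/-- The canonical map `C_c(G) → C*_r(G)`. -/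
noncomputable def toReduced : Cc G →⋆ₙₐ[ℂ] ReducedCStar G := toClosureRange (reducedRep G)

lemma norm_toReduced_le (f : Cc G) : ‖toReduced G f‖ ≤ ‖fullRep G f‖ :=
  norm_directSumHom_le (fun u : UnitSpace G => regularRep u) (fun f => (normI f).toReal)
    (fun u f => regularOperator_norm_le u f) f (norm_nonneg _) fun u =>
    le_norm_directSumHom (fun π : Representation G => π.toHom) (fun f => (normI f).toReal)
      (fun π f => π.norm_le f) f (regularRepresentation G u)

/-- The canonical quotient map `C*(G) → C*_r(G)`, the continuous extension of the identity of
`C_c(G)`. -/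
noncomputable def fullToReduced : FullCStar G →⋆ₙₐ[ℂ] ReducedCStar G :=
  extendHom (fullRep G) (toReduced G) (norm_toReduced_le G)

lemma fullToReduced_toFull (f : Cc G) : fullToReduced G (toFull G f) = toReduced G f :=
  extendHom_apply _ _ _ f

/-- `C*(G) = C*_r(G)`: the canonical quotient map is an isomorphism. -/
def FullEqReduced : Prop := Function.Bijective (fullToReduced G)

end CStarAlgebras

section Restriction

variable (G : Type u) [ArrowGroupoid G]

/-- An invariant set of units: `G · D = {r(γ) : s(γ) ∈ D} ⊆ D`. -/
structure InvariantSet where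
  carrier : Set (UnitSpace G)
  range_mem : ∀ γ : G, sourceMap γ ∈ carrier → rangeMap γ ∈ carrier

variable {G}

namespace InvariantSet

lemma source_mem (D : InvariantSet G) (γ : G) (h : rangeMap γ ∈ D.carrier) : sourceMap γ ∈ D.carrier := by
  have := D.range_mem (inv γ) (by
    rwa [show sourceMap (inv γ) = rangeMap γ from Subtype.ext (src_inv γ)])
  rwa [show rangeMap (inv γ) = sourceMap γ from Subtype.ext (rng_inv γ)] at this

/-- The complement `G⁽⁰⁾ - D`. -/
def compl (D : InvariantSet G) : InvariantSet G where
  carrier := D.carrierᶜ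
  range_mem γ h h' := h (D.source_mem γ h')

end InvariantSet

/-- The restriction `G|_D = {γ : r(γ) ∈ D, s(γ) ∈ D}`, with the subspace topology. -/
abbrev Restrict (D : InvariantSet G) : Type u :=
  {γ : G // rangeMap γ ∈ D.carrier ∧ sourceMap γ ∈ D.carrier}

namespace Restrict

variable {D : InvariantSet G}

lemma ext {γ η : Restrict D} (h : γ.1 = η.1) : γ = η := Subtype.ext h

/-- The operations of `G|_D` are those of `G`. -/
instance : ArrowGroupoid (Restrict D) where
  src γ := ⟨src γ.1, by
    rw [show rangeMap (src γ.1) = sourceMap γ.1 from Subtype.ext (rng_src _),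
      show sourceMap (src γ.1) = sourceMap γ.1 from Subtype.ext (src_src _)]
    exact ⟨γ.2.2, γ.2.2⟩⟩
  rng γ := ⟨rng γ.1, by
    rw [show rangeMap (rng γ.1) = rangeMap γ.1 from Subtype.ext (rng_rng _),
      show sourceMap (rng γ.1) = rangeMap γ.1 from Subtype.ext (src_rng _)]
    exact ⟨γ.2.1, γ.2.1⟩⟩
  comp γ η h := ⟨comp γ.1 η.1 (congrArg Subtype.val h), by
    rw [show rangeMap (comp γ.1 η.1 (congrArg Subtype.val h)) = rangeMap γ.1 from
        Subtype.ext (rng_comp _ _ _),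
      show sourceMap (comp γ.1 η.1 (congrArg Subtype.val h)) = sourceMap η.1 from
        Subtype.ext (src_comp _ _ _)]
    exact ⟨γ.2.1, η.2.2⟩⟩
  inv γ := ⟨inv γ.1, by
    rw [show rangeMap (inv γ.1) = sourceMap γ.1 from Subtype.ext (rng_inv _),
      show sourceMap (inv γ.1) = rangeMap γ.1 from Subtype.ext (src_inv _)]
    exact ⟨γ.2.2, γ.2.1⟩⟩
  src_src γ := Subtype.ext (src_src _)
  rng_src γ := Subtype.ext (rng_src _)
  src_rng γ := Subtype.ext (src_rng _)
  rng_rng γ := Subtype.ext (rng_rng _)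
  src_comp γ η h := Subtype.ext (src_comp _ _ _)
  rng_comp γ η h := Subtype.ext (rng_comp _ _ _)
  comp_assoc γ η κ h k := Subtype.ext
    (comp_assoc _ _ _ (congrArg Subtype.val h) (congrArg Subtype.val k))
  comp_src γ := Subtype.ext (comp_src _)
  rng_comp_self γ := Subtype.ext (rng_comp_self _)
  src_inv γ := Subtype.ext (src_inv _)
  rng_inv γ := Subtype.ext (rng_inv _)
  inv_comp γ := Subtype.ext (inv_comp _)
  comp_inv γ := Subtype.ext (comp_inv _)

/-- A unit of `G|_D` is a unit of `G`. -/
def unit (d : UnitSpace (Restrict D)) : UnitSpace G := ⟨d.1.1, congrArg Subtype.val d.2⟩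

lemma unit_mem (d : UnitSpace (Restrict D)) : unit d ∈ D.carrier := by
  have := d.1.2.2
  rwa [show sourceMap d.1.1 = unit d from source_unit (unit d)] at this

/-- A unit of `G` in `D` is a unit of `G|_D`. -/
def ofUnit (u : UnitSpace G) (hu : u ∈ D.carrier) : UnitSpace (Restrict D) :=
  ⟨⟨u.1, by simpa using hu⟩, Subtype.ext u.2⟩

lemma unit_source (γ : Restrict D) : unit (sourceMap γ) = sourceMap γ.1 := rfl

/-- The fibre over a unit is the same in `G|_D` and in `G`. -/
def fiberEquiv (d : UnitSpace (Restrict D)) :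
    {γ : Restrict D // sourceMap γ = d} ≃ {γ : G // sourceMap γ = unit d} where
  toFun γ := ⟨γ.1.1, congrArg unit γ.2⟩
  invFun γ := ⟨⟨γ.1, D.range_mem _ (γ.2.symm ▸ unit_mem d : sourceMap γ.1 ∈ D.carrier),
    (γ.2.symm ▸ unit_mem d : sourceMap γ.1 ∈ D.carrier)⟩,
    Subtype.ext (Subtype.ext (congrArg (fun v : UnitSpace G => v.1) γ.2))⟩
  left_inv _ := rfl
  right_inv _ := rfl

lemma coe_quot {d : UnitSpace (Restrict D)} (γ ζ : {γ : Restrict D // sourceMap γ = d}) :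
    (divArrow γ ζ).1 = divArrow (fiberEquiv d γ) (fiberEquiv d ζ) := rfl

variable [TopologicalSpace G]

lemma continuous_val : Continuous (Subtype.val : Restrict D → G) := continuous_subtype_val

variable [EtaleGroupoid G]

lemma continuous_unit : Continuous (unit : UnitSpace (Restrict D) → UnitSpace G) :=
  Continuous.subtype_mk (continuous_val.comp continuous_subtype_val) _

lemma continuous_comp_restrict :
    Continuous fun p : {p : Restrict D × Restrict D // src p.1 = rng p.2} =>
      comp p.1.1 p.1.2 p.2 := by
  refine Continuous.subtype_mk (EtaleGroupoid.continuous_comp.comp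
    (Continuous.subtype_mk (f := fun p : {p : Restrict D × Restrict D // src p.1 = rng p.2} =>
      (p.1.1.1, p.1.2.1)) ?_ fun p => congrArg Subtype.val p.2)) _
  exact (continuous_val.comp (continuous_fst.comp continuous_subtype_val)).prodMk
    (continuous_val.comp (continuous_snd.comp continuous_subtype_val))

lemma continuous_source_restrict : Continuous (sourceMap : Restrict D → UnitSpace (Restrict D)) :=
  Continuous.subtype_mk (Continuous.subtype_mk (continuous_src.comp continuous_val) _) _

lemma isOpenMap_source_restrict : IsOpenMap (sourceMap : Restrict D → UnitSpace (Restrict D)) := by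
  rintro W ⟨V, hV, rfl⟩
  have h : sourceMap '' ((Subtype.val : Restrict D → G) ⁻¹' V) =
      unit ⁻¹' ((sourceMap : G → UnitSpace G) '' V) := by
    ext d
    constructor
    · rintro ⟨γ, hγ, rfl⟩; exact ⟨γ.1, hγ, rfl⟩
    · rintro ⟨γ, hγ, hd⟩
      exact ⟨((fiberEquiv d).symm ⟨γ, hd⟩).1, hγ, ((fiberEquiv d).symm ⟨γ, hd⟩).2⟩
  rw [h]
  exact (EtaleGroupoid.isLocalHomeomorph_source.isOpenMap V hV).preimage continuous_unit

instance : EtaleGroupoid (Restrict D) where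
  continuous_comp := continuous_comp_restrict
  continuous_inv :=
    Continuous.subtype_mk (EtaleGroupoid.continuous_inv.comp continuous_val) _
  isLocalHomeomorph_source := by
    rw [isLocalHomeomorph_iff_isOpenEmbedding_restrict]
    intro γ
    obtain ⟨U, hU, hγU, hinj⟩ :=
      (EtaleGroupoid.isLocalHomeomorph_source (G := G)).isLocallyInjective γ.1
    have hU' : IsOpen ((Subtype.val : Restrict D → G) ⁻¹' U) := hU.preimage continuous_val
    refine ⟨_, hU'.mem_nhds hγU, IsOpenEmbedding.of_continuous_injective_isOpenMap
      (continuous_source_restrict.comp continuous_subtype_val) ?_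
      (isOpenMap_source_restrict.comp hU'.isOpenMap_subtype_val)⟩
    intro η κ h
    exact Subtype.ext (Restrict.ext (hinj η.2 κ.2 (congrArg unit h)))

end Restrict

/-- Reindexing `ℓ²` along a bijection. -/
noncomputable def l2Congr {I J : Type*} (e : I ≃ J) :
    lp (fun _ : J => ℂ) 2 ≃ₗᵢ[ℂ] lp (fun _ : I => ℂ) 2 where
  toFun ξ := ⟨fun i => ξ (e i), memℓp_gen (by
    have := (lp.memℓp ξ).summable (by norm_num)
    exact e.summable_iff.2 this)⟩
  invFun ξ := ⟨fun j => ξ (e.symm j), memℓp_gen (by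
    have := (lp.memℓp ξ).summable (by norm_num)
    exact e.symm.summable_iff.2 this)⟩
  left_inv ξ := by ext j; simp
  right_inv ξ := by ext j; simp
  map_add' ξ η := rfl
  map_smul' c ξ := rfl
  norm_map' ξ := by
    rw [lp.norm_eq_tsum_rpow (by norm_num), lp.norm_eq_tsum_rpow (by norm_num)]
    congr 1
    exact e.tsum_eq (fun j => ‖ξ j‖ ^ (2 : ℝ≥0∞).toReal)

namespace Restrict

variable {D : InvariantSet G} [TopologicalSpace G] [EtaleGroupoid G] [T2Space G]

/-- The identification of operators on `ℓ²(Gd)` and on `ℓ²((G|_D)d)`. -/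
noncomputable def operatorEquiv (d : UnitSpace (Restrict D)) :
    (FiberSpace (unit d) →L[ℂ] FiberSpace (unit d)) ≃⋆ₐ[ℂ] (FiberSpace d →L[ℂ] FiberSpace d) :=
  (l2Congr (fiberEquiv d)).conjStarAlgEquiv

lemma regularOperator_restrict (d : UnitSpace (Restrict D)) (f : Cc G) (g : Cc (Restrict D))
    (h : ∀ γ, g γ = f γ.1) :
    regularOperator d g = operatorEquiv d (regularOperator (unit d) f) := by
  ext ξ γ
  change ∑' ζ, g (divArrow γ ζ) * ξ ζ = ∑' ζ, f (divArrow (fiberEquiv d γ) ζ) * ξ ((fiberEquiv d).symm ζ)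
  rw [← (fiberEquiv d).tsum_eq]
  refine tsum_congr fun ζ => ?_
  rw [h, coe_quot, Equiv.symm_apply_apply]

lemma norm_operatorEquiv (d : UnitSpace (Restrict D))
    (T : FiberSpace (unit d) →L[ℂ] FiberSpace (unit d)) : ‖operatorEquiv d T‖ = ‖T‖ :=
  NonUnitalStarAlgHom.norm_map (operatorEquiv d) (operatorEquiv d).injective T

end Restrict

section Maps

variable [TopologicalSpace G] [EtaleGroupoid G] [T2Space G] (D : InvariantSet G)

/-- `G|_D` as a subset of `G`, described through sources alone. -/
lemma restrict_set_eq : {γ : G | rangeMap γ ∈ D.carrier ∧ sourceMap γ ∈ D.carrier} =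
    sourceMap ⁻¹' D.carrier := by
  ext γ
  exact ⟨fun h => h.2, fun h => ⟨D.range_mem γ h, h⟩⟩

lemma isClosedEmbedding_val (hD : IsClosed D.carrier) :
    IsClosedEmbedding (Subtype.val : Restrict D → G) :=
  IsClosed.isClosedEmbedding_subtypeVal (by
    have h : IsClosed {γ : G | rangeMap γ ∈ D.carrier ∧ sourceMap γ ∈ D.carrier} := by
      rw [restrict_set_eq D]; exact hD.preimage continuous_source
    exact h)

lemma isOpen_set (hD : IsOpen D.carrier) :
    IsOpen {γ : G | rangeMap γ ∈ D.carrier ∧ sourceMap γ ∈ D.carrier} :=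
  restrict_set_eq D ▸ hD.preimage continuous_source

/-- Restriction of functions `C_c(G) → C_c(G|_D)`, for `D` closed and invariant. -/
noncomputable def restrictFun (hD : IsClosed D.carrier) (f : Cc G) : Cc (Restrict D) :=
  Cc.mk (fun γ => f γ.1) (f.continuous.comp Restrict.continuous_val)
    (f.hasCompactSupport.comp_isClosedEmbedding (isClosedEmbedding_val D hD))

lemma extend_eq (f : Restrict D → ℂ) (γ : G)
    (h : rangeMap γ ∈ D.carrier ∧ sourceMap γ ∈ D.carrier) :
    Function.extend (Subtype.val : Restrict D → G) f 0 γ = f ⟨γ, h⟩ :=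
  Subtype.val_injective.extend_apply f 0 (⟨γ, h⟩ : Restrict D)

lemma extend_eq_zero (f : Restrict D → ℂ) (γ : G) (h : sourceMap γ ∉ D.carrier) :
    Function.extend (Subtype.val : Restrict D → G) f 0 γ = 0 :=
  Function.extend_apply' (f := (Subtype.val : Restrict D → G)) f (0 : G → ℂ) γ
    (by rintro ⟨η, rfl⟩; exact h η.2.2)

/-- Extension of functions by zero `C_c(G|_U) → C_c(G)`, for `U` open and invariant. -/
noncomputable def extendFun (hD : IsOpen D.carrier) (f : Cc (Restrict D)) : Cc G :=
  Cc.mk (Function.extend (Subtype.val : Restrict D → G) f 0)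
    (f.hasCompactSupport.continuous_extend_zero (isOpen_set D hD) f.continuous)
    (f.hasCompactSupport.extend_zero Restrict.continuous_val)

/-- Restriction of functions as a `*`-homomorphism. -/
noncomputable def restrictHom (hD : IsClosed D.carrier) : Cc G →⋆ₙₐ[ℂ] Cc (Restrict D) where
  toFun := restrictFun D hD
  map_smul' c f := rfl
  map_zero' := rfl
  map_add' f g := rfl
  map_mul' f g := regularOperator_injective fun d => by
    rw [regularOperator_mul, Restrict.regularOperator_restrict d (f * g) _ fun _ => rfl,
      Restrict.regularOperator_restrict d f _ fun _ => rfl,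
      Restrict.regularOperator_restrict d g _ fun _ => rfl, regularOperator_mul, map_mul]
  map_star' f := rfl

lemma regularOperator_extend_of_mem (hD : IsOpen D.carrier) (f : Cc (Restrict D))
    (d : UnitSpace (Restrict D)) :
    regularOperator d f =
      Restrict.operatorEquiv d (regularOperator (Restrict.unit d) (extendFun D hD f)) :=
  Restrict.regularOperator_restrict d _ _ fun γ => (extend_eq D f γ.1 γ.2).symm

lemma regularOperator_extend_of_notMem (hD : IsOpen D.carrier) (f : Cc (Restrict D))
    (u : UnitSpace G) (hu : u ∉ D.carrier) : regularOperator u (extendFun D hD f) = 0 := by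
  classical
  refine operator_ext fun γ ζ => ?_
  rw [regularOperator_single]
  refine extend_eq_zero D f _ fun h => hu ?_
  rw [source_quot] at h
  exact ζ.2 ▸ D.source_mem _ h

lemma extendFun_mul (hD : IsOpen D.carrier) (f g : Cc (Restrict D)) :
    extendFun D hD (f * g) = extendFun D hD f * extendFun D hD g := by
  refine regularOperator_injective fun u => ?_
  by_cases hu : u ∈ D.carrier
  · have h := fun f => regularOperator_extend_of_mem D hD f (Restrict.ofUnit u hu)
    have h2 : regularOperator (Restrict.ofUnit u hu) (f * g) = _ := h (f * g)
    rw [regularOperator_mul, h f, h g, ← map_mul, ← regularOperator_mul] at h2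
    exact (Restrict.operatorEquiv (Restrict.ofUnit u hu)).injective h2.symm
  · rw [regularOperator_mul]
    simp only [regularOperator_extend_of_notMem D hD _ u hu, mul_zero]

/-- Extension of functions by zero as a `*`-homomorphism. -/
noncomputable def extendZeroHom (hD : IsOpen D.carrier) : Cc (Restrict D) →⋆ₙₐ[ℂ] Cc G where
  toFun := extendFun D hD
  map_smul' c f := by
    ext γ
    by_cases h : sourceMap γ ∈ D.carrier
    · have h' := And.intro (D.range_mem γ h) h
      simp [extendFun, extend_eq D _ γ h']
    · simp [extendFun, extend_eq_zero D _ γ h]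
  map_zero' := by
    ext γ
    by_cases h : sourceMap γ ∈ D.carrier
    · have h' := And.intro (D.range_mem γ h) h
      simp [extendFun, extend_eq D _ γ h']
    · simp [extendFun, extend_eq_zero D _ γ h]
  map_add' f g := by
    ext γ
    by_cases h : sourceMap γ ∈ D.carrier
    · have h' := And.intro (D.range_mem γ h) h
      simp [extendFun, extend_eq D _ γ h']
    · simp [extendFun, extend_eq_zero D _ γ h]
  map_mul' := extendFun_mul D hD
  map_star' f := by
    ext γ
    have hi : sourceMap (inv γ) = rangeMap γ := Subtype.ext (src_inv γ)
    by_cases h : sourceMap γ ∈ D.carrier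
    · have h' := And.intro (D.range_mem γ h) h
      have h'' : rangeMap (inv γ) ∈ D.carrier ∧ sourceMap (inv γ) ∈ D.carrier :=
        (inv (⟨γ, h'⟩ : Restrict D)).2
      simp only [extendFun, Cc.mk_apply, Cc.star_apply, extend_eq D _ γ h',
        extend_eq D _ (inv γ) h'']
      rfl
    · have h' : sourceMap (inv γ) ∉ D.carrier := fun hh => h (D.source_mem γ (hi ▸ hh))
      simp [extendFun, extend_eq_zero D _ γ h, extend_eq_zero D _ _ h']

lemma norm_toReduced_restrict_le (hD : IsClosed D.carrier) (f : Cc G) :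
    ‖(toReduced (Restrict D)).comp (restrictHom D hD) f‖ ≤ ‖reducedRep G f‖ := by
  refine norm_directSumHom_le (fun d : UnitSpace (Restrict D) => regularRep d)
    (fun f => (normI f).toReal) (fun d f => regularOperator_norm_le d f) _ (norm_nonneg _)
    fun d => ?_
  change ‖regularOperator d (restrictFun D hD f)‖ ≤ _
  rw [Restrict.regularOperator_restrict d f _ fun _ => rfl, Restrict.norm_operatorEquiv]
  exact le_norm_directSumHom (fun u : UnitSpace G => regularRep u) (fun f => (normI f).toReal)
    (fun u f => regularOperator_norm_le u f) f (Restrict.unit d)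

lemma norm_toReduced_extend_le (hD : IsOpen D.carrier) (f : Cc (Restrict D)) :
    ‖(toReduced G).comp (extendZeroHom D hD) f‖ ≤ ‖reducedRep (Restrict D) f‖ := by
  refine norm_directSumHom_le (fun u : UnitSpace G => regularRep u)
    (fun f => (normI f).toReal) (fun u f => regularOperator_norm_le u f) _ (norm_nonneg _)
    fun u => ?_
  change ‖regularOperator u (extendFun D hD f)‖ ≤ _
  by_cases hu : u ∈ D.carrier
  · have h := regularOperator_extend_of_mem D hD f (Restrict.ofUnit u hu)
    have h2 := congrArg norm h
    rw [Restrict.norm_operatorEquiv] at h2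
    refine h2.symm.le.trans ?_
    exact le_norm_directSumHom (fun d : UnitSpace (Restrict D) => regularRep d)
      (fun f => (normI f).toReal) (fun d f => regularOperator_norm_le d f) f (Restrict.ofUnit u hu)
  · rw [regularOperator_extend_of_notMem D hD f u hu, norm_zero]
    exact norm_nonneg _

/-- `ρ_r : C*_r(G) → C*_r(G|_D)`, the continuous extension of the restriction map. -/
noncomputable def rhoReduced (hD : IsClosed D.carrier) :
    ReducedCStar G →⋆ₙₐ[ℂ] ReducedCStar (Restrict D) :=
  extendHom (reducedRep G) ((toReduced (Restrict D)).comp (restrictHom D hD))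
    (norm_toReduced_restrict_le D hD)

/-- `ι_r : C*_r(G|_U) → C*_r(G)`, the continuous extension of the extension map. -/
noncomputable def iotaReduced (hD : IsOpen D.carrier) :
    ReducedCStar (Restrict D) →⋆ₙₐ[ℂ] ReducedCStar G :=
  extendHom (reducedRep (Restrict D)) ((toReduced G).comp (extendZeroHom D hD))
    (norm_toReduced_extend_le D hD)

lemma rhoReduced_toReduced (hD : IsClosed D.carrier) (f : Cc G) :
    rhoReduced D hD (toReduced G f) = toReduced (Restrict D) (restrictHom D hD f) :=
  extendHom_apply _ _ _ f

lemma iotaReduced_toReduced (hD : IsOpen D.carrier) (f : Cc (Restrict D)) :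
    iotaReduced D hD (toReduced (Restrict D) f) = toReduced G (extendZeroHom D hD f) :=
  extendHom_apply _ _ _ f

/-- Exactness of `0 → C*_r(G|_{G⁽⁰⁾ - D}) → C*_r(G) → C*_r(G|_D) → 0`. -/
def ReducedSequenceExact (hD : IsClosed D.carrier) : Prop :=
  Function.Injective (iotaReduced D.compl hD.isOpen_compl) ∧
  Function.Exact (iotaReduced D.compl hD.isOpen_compl) (rhoReduced D hD) ∧
  Function.Surjective (rhoReduced D hD)

end Maps

end Restriction
end GroupoidCStar

namespace GroupoidCStar

open Topology Set Filter ArrowGroupoid EtaleGroupoid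
open scoped ENNReal ComplexOrder

set_option linter.unusedSectionVars false

universe u v

/-! ### Lifting with norm control along `*`-homomorphisms -/

section CStarHomomorphisms

variable {A B C : Type*} [NonUnitalCStarAlgebra A] [NonUnitalCStarAlgebra B]
  [NonUnitalCStarAlgebra C]

/-! For every closed invariant `D` the map `ι_r` is injective, `ρ_r` is surjective and `ρ_r ∘ ι_r =
0`. So condition 2 says only that the kernel of `ρ_r` is contained in the range of `ι_r`. Each
compactly supported function vanishing on `G|_D` does lie in that range
(`toReduced_mem_range_iotaReduced`), but an element of the kernel need not be a limit of such
functions. The quotient of `C*_r(G)` by the range of `ι_r` is a completion of `C_c(G|_D)` in a norm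
between the reduced and the full one; the lemma compares it with these two ends.

From 1 to 2: if `x` is in the kernel of `ρ_r` but not in the ideal `range ι_r`, some representation
`π` of `C*_r(G)` kills the ideal and not `x` (`exists_representation_of_notMem_ideal`). It descends
to `C_c(G|_D)`, and the result is `I`-norm decreasing because a function on `G|_D` lifts to `G`
without increase of the `I`-norm (`exists_normI_le_normI_restrictHom`). Hence `‖π(f)‖` is at most
the full norm of `f|_D`, which is its reduced norm. By density `‖π(x)‖ ≤ ‖ρ_r(x)‖ = 0`, a
contradiction.

From 2 to 1: a representation `σ` of `C_c(G|_D)`, composed with restriction, is an `I`-norm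
decreasing representation of `C_c(G)`. Since `C*(G) = C*_r(G)`, it extends to `C*_r(G)`. The
extension kills `range ι_r`, which by exactness is the kernel of `ρ_r`, so it is dominated by `ρ_r`
(`norm_le_of_ker_le`). This bounds `‖σ(g)‖` by the reduced norm of `g`. -/

lemma continuous_starHom (φ : B →⋆ₙₐ[ℂ] C) : Continuous φ :=
  AddMonoidHomClass.continuous_of_bound φ 1 fun x => by
    simpa using NonUnitalStarAlgHom.norm_apply_le φ x

/-- A selfadjoint element in the range of a `*`-homomorphism of `C*`-algebras has a preimage of
no larger norm. -/
lemma exists_lift_norm_le (φ : A →⋆ₙₐ[ℂ] B) (a : A) (ha : IsSelfAdjoint a) :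
    ∃ a' : A, φ a' = φ a ∧ ‖a'‖ ≤ ‖φ a‖ := by
  -- Truncation to the interval `[-‖φ a‖, ‖φ a‖]`. It is the identity on the spectrum of `φ a`, so
  -- `f(a)` has the same image as `a`, and its norm is at most the bound of `f`.
  let f : ℝ → ℝ := fun t => max (-‖φ a‖) (min t ‖φ a‖)
  have hf : Continuous f := by fun_prop
  have hf0 : f 0 = 0 := by simp [f]
  have hφa : IsSelfAdjoint (φ a) := ha.map φ
  refine ⟨cfcₙ f a, ?_, norm_cfcₙ_le fun x _ => ?_⟩
  · rw [NonUnitalStarAlgHom.map_cfcₙ φ f a hf.continuousOn hf0 (continuous_starHom φ) ha hφa]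
    conv_rhs => rw [← cfcₙ_id ℝ (φ a)]
    refine cfcₙ_congr fun x hx => ?_
    have h : ‖x‖ ≤ ‖φ a‖ := by
      simpa [cfcₙ_id ℝ (φ a)] using norm_apply_le_norm_cfcₙ (id : ℝ → ℝ) (φ a) hx
    rw [Real.norm_eq_abs, abs_le] at h
    simp [f, h.1, h.2]
  · rw [Real.norm_eq_abs, abs_le]
    exact ⟨le_max_left _ _, max_le (by linarith [norm_nonneg (φ a)]) (min_le_right _ _)⟩

/-- A `*`-homomorphism of `C*`-algebras with dense range is surjective. -/
lemma surjective_of_denseRange (φ : A →⋆ₙₐ[ℂ] B) (h : DenseRange φ) : Function.Surjective φ := by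
  have hsmul : ∀ (r : ℝ) a, φ (r • a) = r • φ a := fun r a => by
    rw [← Complex.coe_smul, map_smul, Complex.coe_smul]
  let f : NormedAddGroupHom A B := (φ : A →+ B).mkNormedAddGroupHom 1 fun x => by
    simpa using NonUnitalStarAlgHom.norm_apply_le φ x
  -- The constant 2 counts the real and the imaginary part, each lifted with norm at most `‖φ a‖`.
  have hK : f.SurjectiveOnWith f.range 2 := by
    rintro _ ⟨a, rfl⟩
    obtain ⟨b, hb, hbn⟩ := exists_lift_norm_le φ (realPart a : A) (realPart a).2
    obtain ⟨c, hc, hcn⟩ := exists_lift_norm_le φ (imaginaryPart a : A) (imaginaryPart a).2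
    have hre : φ (realPart a : A) = (realPart (φ a) : B) := by
      simp only [realPart_apply_coe, hsmul, map_add, map_star]
    have him : φ (imaginaryPart a : A) = (imaginaryPart (φ a) : B) := by
      simp only [imaginaryPart_apply_coe, hsmul, map_smul, map_sub, map_star]
    have hren : ‖(realPart (φ a) : B)‖ ≤ ‖φ a‖ := realPart.norm_le (φ a)
    have himn : ‖(imaginaryPart (φ a) : B)‖ ≤ ‖φ a‖ := imaginaryPart.norm_le (φ a)
    refine ⟨b + Complex.I • c, ?_, ?_⟩
    · change φ (b + Complex.I • c) = φ a
      rw [map_add, map_smul, hb, hc, hre, him, realPart_add_I_smul_imaginaryPart]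
    · change _ ≤ 2 * ‖φ a‖
      refine (norm_add_le _ _).trans ?_
      rw [norm_smul, Complex.norm_I, one_mul]
      rw [hre] at hbn
      rw [him] at hcn
      linarith
  -- Lifts of controlled norm can be summed along a convergent series, so every point of the closure
  -- of the range, here everything, is attained.
  have hcl := controlled_closure_of_complete two_pos one_pos hK
  intro b
  obtain ⟨a, ha, -⟩ := hcl b (h b)
  exact ⟨a, ha⟩

/-- A `*`-homomorphism vanishing on the kernel of another one is dominated by it. -/
lemma norm_le_of_ker_le (φ : A →⋆ₙₐ[ℂ] B) (ψ : A →⋆ₙₐ[ℂ] C) (h : ∀ a, φ a = 0 → ψ a = 0)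
    (a : A) : ‖ψ a‖ ≤ ‖φ a‖ := by
  -- Norm control is available for selfadjoint elements, so `a` is replaced by `star a * a`; the
  -- `C*`-identity recovers `a`. The lift differs from `star a * a` by an element of the kernel of
  -- `φ`, which `ψ` does not see.
  obtain ⟨a', ha', hn⟩ := exists_lift_norm_le φ (star a * a) (.star_mul_self a)
  have h1 : ψ a' = ψ (star a * a) := by
    rw [← sub_eq_zero, ← map_sub]
    exact h _ (by rw [map_sub, ha', sub_self])
  have h2 : ‖ψ a‖ * ‖ψ a‖ ≤ ‖φ a‖ * ‖φ a‖ := by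
    rw [← CStarRing.norm_star_mul_self, ← CStarRing.norm_star_mul_self, ← map_star, ← map_star,
      ← map_mul, ← map_mul, ← h1]
    exact (NonUnitalStarAlgHom.norm_apply_le ψ a').trans hn
  exact abs_le_of_sq_le_sq' (by simpa [sq] using h2) (norm_nonneg _) |>.2

end CStarHomomorphisms

/-! ### Representations that kill a closed ideal -/

section QuotientRepresentation

variable {A : Type v} {J I : Type*} [NonUnitalCStarAlgebra A] [NonUnitalCStarAlgebra J]
  {H : I → Type*} [∀ i, NormedAddCommGroup (H i)] [∀ i, InnerProductSpace ℂ (H i)]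
  [∀ i, CompleteSpace (H i)]

/-- Limits of vector functionals along an ultrafilter. -/
lemma exists_limit_functional {E : Type*} (U : Ultrafilter E) (i : E → I)
    (ρ : ∀ i, A →⋆ₙₐ[ℂ] (H i →L[ℂ] H i)) (ζ : ∀ e, H (i e)) (M : ℝ)
    (hζ : ∀ᶠ e in (U : Filter E), ‖ζ e‖ ≤ M) :
    ∃ F : A →ₗ[ℂ] ℂ, Continuous F ∧
      ∀ a, Tendsto (fun e => inner ℂ (ζ e) (ρ (i e) a (ζ e))) U (𝓝 (F a)) := by
  let g : A → E → ℂ := fun a e => inner ℂ (ζ e) (ρ (i e) a (ζ e))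
  have hb : ∀ a, ∀ᶠ e in (U : Filter E), ‖g a e‖ ≤ ‖a‖ * (M * M) := by
    intro a
    filter_upwards [hζ] with e he
    have hM : 0 ≤ M := (norm_nonneg _).trans he
    calc ‖g a e‖ ≤ ‖ζ e‖ * (‖a‖ * ‖ζ e‖) := (norm_inner_le_norm _ _).trans (by
            gcongr
            exact ((ρ (i e) a).le_opNorm _).trans (by
              gcongr; exact NonUnitalStarAlgHom.norm_apply_le _ _))
      _ = ‖a‖ * (‖ζ e‖ * ‖ζ e‖) := by ring
      _ ≤ ‖a‖ * (M * M) := by gcongr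
  -- A bounded family in `ℂ` converges along an ultrafilter. The same ultrafilter serves all `a`,
  -- which makes the limit linear in `a`.
  have hlim : ∀ a, ∃ z : ℂ, Tendsto (g a) U (𝓝 z) := by
    intro a
    obtain ⟨z, -, hz⟩ := (isCompact_closedBall (0 : ℂ) (‖a‖ * (M * M))).ultrafilter_le_nhds'
      (U.map (g a)) (by
        rw [Ultrafilter.mem_map]
        exact Filter.mem_of_superset (hb a) fun e he => by simpa using he)
    exact ⟨z, hz⟩
  choose F hF using hlim
  have hn : ∀ a, ‖F a‖ ≤ (M * M) * ‖a‖ := fun a =>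
    le_of_tendsto (hF a).norm ((hb a).mono fun e he => he.trans_eq (mul_comm _ _))
  let F' : A →ₗ[ℂ] ℂ :=
    { toFun := F
      map_add' := fun a b => tendsto_nhds_unique (hF (a + b)) (by
        refine ((hF a).add (hF b)).congr fun e => ?_
        simp [g])
      map_smul' := fun c a => tendsto_nhds_unique (hF (c • a)) (by
        refine ((hF a).const_smul c).congr fun e => ?_
        simp [g]) }
  exact ⟨F', AddMonoidHomClass.continuous_of_bound F' _ hn, hF⟩

/-- An element outside a closed two-sided ideal of a `C*`-algebra is not killed by some
representation that kills the ideal. -/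
lemma exists_representation_of_notMem_ideal (ρ : ∀ i, A →⋆ₙₐ[ℂ] (H i →L[ℂ] H i))
    (hρ : ∀ a r, r < ‖a‖ → 0 ≤ r → ∃ i, r < ‖ρ i a‖)
    (ι : J →⋆ₙₐ[ℂ] A) (hι : Function.Injective ι)
    (hideal : ∀ a j, a * ι j ∈ range ι) (x : A) (hx : x ∉ range ι) :
    ∃ (K : Type v) (_ : NormedAddCommGroup K) (_ : InnerProductSpace ℂ K) (_ : CompleteSpace K)
      (π : A →⋆ₙₐ[ℂ] (K →L[ℂ] K)), (∀ j, π (ι j) = 0) ∧ π x ≠ 0 := by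
  let _ := CStarAlgebra.spectralOrder A
  let _ := CStarAlgebra.spectralOrderedRing A
  let _ := CStarAlgebra.spectralOrder J
  let _ := CStarAlgebra.spectralOrderedRing J
  have hiso : Isometry ι := NonUnitalStarAlgHom.isometry ι hι
  have hcl : IsClosed (range ι) := hiso.isClosedEmbedding.isClosed_range
  -- A positive distance from `x` to the closed ideal; halving the radius makes the inequality
  -- strict, as the choice of norming vectors requires.
  obtain ⟨c, hc, hcx⟩ : ∃ c > 0, ∀ j, c < ‖x - ι j‖ := by
    obtain ⟨c, hc, hball⟩ := Metric.isOpen_iff.1 hcl.isOpen_compl x hx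
    refine ⟨c / 2, half_pos hc, fun j => ?_⟩
    by_contra! hj
    refine hball (a := ι j) ?_ ⟨j, rfl⟩
    rw [Metric.mem_ball, dist_comm, dist_eq_norm]
    linarith
  -- Since `x * ι e` lies in the ideal, `x - x * ι e` has norm above `c` for every `e`, and some
  -- representation of the norming family `ρ` has a vector witnessing this.
  have hvec : ∀ e : J, ∃ (i : I) (ξ : H i), ‖ξ‖ ≤ 1 ∧ c < ‖ρ i (x - x * ι e) ξ‖ := by
    intro e
    obtain ⟨j, hj⟩ := hideal x e
    obtain ⟨i, hi⟩ := hρ (x - x * ι e) c (hj ▸ hcx j) hc.le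
    obtain ⟨ξ, hξ, h⟩ := (ρ i (x - x * ι e)).exists_lt_apply_of_lt_opNorm hi
    exact ⟨i, ξ, hξ.le, h⟩
  choose i ξ hξ hcξ using hvec
  -- This is `(1 - e) ξ_e`. As `e` runs through an approximate unit of the ideal, these vectors are
  -- asymptotically annihilated by the ideal, while `x` keeps them at norm above `c`.
  let ζ : ∀ e, H (i e) := fun e => ξ e - ρ (i e) (ι e) (ξ e)
  have hρζ : ∀ a e, ρ (i e) a (ζ e) = ρ (i e) (a - a * ι e) (ξ e) := by
    intro a e
    simp [ζ, map_sub, map_mul]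
  let U : Ultrafilter J := Ultrafilter.of (CStarAlgebra.approximateUnit J)
  have hU : (U : Filter J) ≤ CStarAlgebra.approximateUnit J := Ultrafilter.of_le _
  have hau := CStarAlgebra.increasingApproximateUnit J
  have hζ : ∀ᶠ e in (U : Filter J), ‖ζ e‖ ≤ 2 := by
    filter_upwards [hU hau.eventually_norm] with e he
    have h1 : ‖ρ (i e) (ι e) (ξ e)‖ ≤ 1 * 1 :=
      ((ρ (i e) (ι e)).le_opNorm _).trans (by
        gcongr
        · exact (NonUnitalStarAlgHom.norm_apply_le _ _).trans
            ((NonUnitalStarAlgHom.norm_apply_le _ _).trans he)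
        · exact hξ e)
    exact (norm_sub_le _ _).trans (by linarith [hξ e])
  obtain ⟨F, hFc, hF⟩ := exists_limit_functional U i ρ ζ 2 hζ
  have hsq : ∀ a, Tendsto (fun e => ((‖ρ (i e) a (ζ e)‖ ^ 2 : ℝ) : ℂ)) U
      (𝓝 (F (star a * a))) := by
    intro a
    refine (hF (star a * a)).congr fun e => ?_
    rw [map_mul, map_star, ContinuousLinearMap.star_eq_adjoint, mul_apply_eq_comp,
      ContinuousLinearMap.adjoint_inner_right, inner_self_eq_norm_sq_to_K]
    simp
  have hsq' : ∀ a, Tendsto (fun e => ‖ρ (i e) a (ζ e)‖ ^ 2) U (𝓝 (F (star a * a)).re) :=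
    fun a => ((Complex.continuous_re.tendsto _).comp (hsq a)).congr fun e => Complex.ofReal_re _
  -- In fact `F (star x * x) ≥ c ^ 2`.
  have hFx : F (star x * x) ≠ 0 := by
    intro h0
    have h1 : c ^ 2 ≤ (F (star x * x)).re := by
      refine ge_of_tendsto (hsq' x) (.of_forall fun e => ?_)
      rw [hρζ]
      gcongr
      exact (hcξ e).le
    rw [h0, Complex.zero_re] at h1
    nlinarith
  -- `ρ (ι j) ζ_e = ρ (ι (j - j e)) ξ_e`, and `j - j e` tends to `0`.
  have hFι : ∀ j, F (star (ι j) * ι j) = 0 := by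
    intro j
    refine tendsto_nhds_unique (hsq (ι j)) ?_
    have h1 : Tendsto (fun e => ‖j - j * e‖) U (𝓝 0) := by
      have := (tendsto_const_nhds (x := j)).sub ((hau.tendsto_mul_left j).mono_left hU)
      simpa using this.norm
    have h2 : Tendsto (fun e => ‖ρ (i e) (ι j) (ζ e)‖) U (𝓝 0) := by
      refine squeeze_zero (fun _ => norm_nonneg _) (fun e => ?_) h1
      rw [hρζ, ← map_mul, ← map_sub]
      refine ((ρ (i e) _).le_opNorm _).trans ?_
      calc ‖ρ (i e) (ι (j - j * e))‖ * ‖ξ e‖ ≤ ‖j - j * e‖ * 1 := by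
            gcongr
            · exact (NonUnitalStarAlgHom.norm_apply_le _ _).trans
                (NonUnitalStarAlgHom.norm_apply_le _ _)
            · exact hξ e
        _ = _ := mul_one _
    have h3 := (Complex.continuous_ofReal.tendsto _).comp (h2.pow 2)
    simpa [Function.comp_def] using h3
  have hpos : ∀ a, 0 ≤ a → 0 ≤ F a := by
    intro a ha
    obtain ⟨b, rfl⟩ := CStarAlgebra.nonneg_iff_eq_star_mul_self.1 ha
    exact ge_of_tendsto (hsq b) (.of_forall fun e => by
      rw [Complex.zero_le_real]; positivity)
  let f : A →ₚ[ℂ] ℂ := PositiveLinearMap.mk₀ F hpos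
  have hnorm : ∀ (a : A) (b : f.PreGNS), ((‖f.leftMulMapPreGNS a b‖ ^ 2 : ℝ) : ℂ) =
      F (star (a * f.ofPreGNS b) * (a * f.ofPreGNS b)) := by
    intro a b
    rw [Complex.ofReal_pow, f.preGNS_norm_sq]
    rfl
  -- The GNS space is a completion of `A` with a new inner product, so it lives in the universe of
  -- `A`. For `C*_r(G)` this is the universe that `Representation` demands.
  refine ⟨f.GNS, inferInstance, inferInstance, inferInstance, f.gnsNonUnitalStarAlgHom, ?_, ?_⟩
  · intro j
    ext b
    induction b using UniformSpace.Completion.induction_on with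
    | hp => exact isClosed_eq (by fun_prop) (by fun_prop)
    | ih b =>
      rw [f.gnsNonUnitalStarAlgHom_apply_coe]
      -- `hideal` gives absorption from the left only; taking adjoints gives it from the right, so
      -- `ι j * b` is again in the ideal and has seminorm zero for `F`.
      obtain ⟨k, hk⟩ := hideal (star (f.ofPreGNS b)) (star j)
      have hk' : ι j * f.ofPreGNS b = ι (star k) := by
        rw [map_star, hk, map_star, star_mul, star_star, star_star]
      have h := hnorm (ι j) b
      rw [hk', hFι] at h
      change _ = (0 : f.GNS)
      rw [← norm_eq_zero, UniformSpace.Completion.norm_coe]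
      simpa using h
  · intro hx0
    apply hFx
    -- `A` need not have a unit, hence no cyclic vector given by `1`; the classes of an approximate
    -- unit take its place.
    have hauA := CStarAlgebra.increasingApproximateUnit A
    have h1 : Tendsto (fun b => F (star (x * b) * (x * b))) (CStarAlgebra.approximateUnit A)
        (𝓝 (F (star x * x))) := by
      have hcont : Continuous fun y : A => F (star y * y) := hFc.comp (by fun_prop)
      exact (hcont.tendsto x).comp (hauA.tendsto_mul_left x)
    refine tendsto_nhds_unique h1 (tendsto_const_nhds.congr fun b => ?_)
    have h2 := hnorm x (f.toPreGNS b)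
    have h3 : ((f.leftMulMapPreGNS x (f.toPreGNS b) : f.PreGNS) : f.GNS) = 0 := by
      rw [← f.gnsNonUnitalStarAlgHom_apply_coe, hx0]; rfl
    rw [← UniformSpace.Completion.norm_coe, h3, norm_zero] at h2
    simpa using h2

end QuotientRepresentation

/-! ### `I`-norms under restriction and extension of functions -/

section RestrictionOfFunctions

variable {G : Type u} [ArrowGroupoid G]

/-- The range fibre over a unit is the same in `G|_D` and in `G`. -/
def Restrict.rangeFiberEquiv {D : InvariantSet G} (d : UnitSpace (Restrict D)) :
    {γ : Restrict D // rangeMap γ = d} ≃ {γ : G // rangeMap γ = unit d} where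
  toFun γ := ⟨γ.1.1, congrArg unit γ.2⟩
  invFun γ := ⟨⟨γ.1, (γ.2.symm ▸ unit_mem d : rangeMap γ.1 ∈ D.carrier),
    D.source_mem _ (γ.2.symm ▸ unit_mem d : rangeMap γ.1 ∈ D.carrier)⟩,
    Subtype.ext (Subtype.ext (congrArg (fun v : UnitSpace G => v.1) γ.2))⟩
  left_inv _ := rfl
  right_inv _ := rfl

variable [TopologicalSpace G]

lemma isOpen_compl_carrier {D : InvariantSet G} (hD : IsClosed D.carrier) :
    IsOpen D.compl.carrier := hD.isOpen_compl

/-- The sum of `‖f‖` over a source fibre. -/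
noncomputable def sourceSum (f : Cc G) (u : UnitSpace G) : ℝ≥0∞ :=
  ∑' γ : {γ : G // sourceMap γ = u}, ‖f γ.1‖ₑ

/-- The sum of `‖f‖` over a range fibre. -/
noncomputable def rangeSum (f : Cc G) (u : UnitSpace G) : ℝ≥0∞ :=
  ∑' γ : {γ : G // rangeMap γ = u}, ‖f γ.1‖ₑ

lemma sourceSum_le_normI (f : Cc G) (u : UnitSpace G) : sourceSum f u ≤ normI f :=
  (le_max_left _ _).trans (le_iSup (fun u => max (sourceSum f u) (rangeSum f u)) u)

lemma rangeSum_le_normI (f : Cc G) (u : UnitSpace G) : rangeSum f u ≤ normI f :=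
  (le_max_right _ _).trans (le_iSup (fun u => max (sourceSum f u) (rangeSum f u)) u)

lemma normI_le_iff (f : Cc G) (C : ℝ≥0∞) :
    normI f ≤ C ↔ ∀ u, sourceSum f u ≤ C ∧ rangeSum f u ≤ C := by
  simp only [← max_le_iff]
  exact iSup_le_iff

/-- Used with `k` equal to `1` on the support of `f`, to turn a uniform bound into an `I`-norm
bound. -/
lemma normI_le_mul (f k : Cc G) (c : ℝ≥0∞) (h : ∀ γ, ‖f γ‖ₑ ≤ c * ‖k γ‖ₑ) :
    normI f ≤ c * normI k := by
  refine (normI_le_iff _ _).2 fun u => ⟨?_, ?_⟩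
  · calc sourceSum f u ≤ c * sourceSum k u := by
          unfold sourceSum
          rw [← ENNReal.tsum_mul_left]
          exact ENNReal.tsum_le_tsum fun γ => h γ.1
      _ ≤ _ := by gcongr; exact sourceSum_le_normI k u
  · calc rangeSum f u ≤ c * rangeSum k u := by
          unfold rangeSum
          rw [← ENNReal.tsum_mul_left]
          exact ENNReal.tsum_le_tsum fun γ => h γ.1
      _ ≤ _ := by gcongr; exact rangeSum_le_normI k u

lemma eq_zero_of_normI_eq_zero (f : Cc G) (h : normI f = 0) : f = 0 := by
  ext γ
  have h1 := sourceSum_le_normI f (sourceMap γ)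
  rw [h, nonpos_iff_eq_zero, sourceSum, ENNReal.tsum_eq_zero] at h1
  simpa using h1 ⟨γ, rfl⟩

variable [EtaleGroupoid G] [T2Space G]

/-- The étale condition makes fibre sums continuous in the unit; the damping factor built from them
below is then continuous too. -/
lemma continuous_fiberSum_enorm (f : Cc G) {p : G → UnitSpace G} (hp : IsLocalHomeomorph p) :
    Continuous fun u : UnitSpace G => ∑' γ : {γ : G // p γ = u}, ‖f γ.1‖ₑ :=
  continuous_fiberSum (q := id) hp f.hasCompactSupport.isCompact continuous_id
    (fun y => ‖f y.1.2‖ₑ)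
    (f.continuous.comp (continuous_snd.comp continuous_subtype_val)).enorm
    (fun y hy => by rw [f.eq_zero_of_notMem hy, enorm_zero])

lemma continuous_sourceSum (f : Cc G) : Continuous (sourceSum f) :=
  continuous_fiberSum_enorm f isLocalHomeomorph_source

lemma continuous_rangeSum (f : Cc G) : Continuous (rangeSum f) :=
  continuous_fiberSum_enorm f isLocalHomeomorph_range

lemma sourceSum_ne_top (f : Cc G) (u : UnitSpace G) : sourceSum f u ≠ ⊤ :=
  ne_top_of_le_ne_top (normI_ne_top f) (sourceSum_le_normI f u)

lemma rangeSum_ne_top (f : Cc G) (u : UnitSpace G) : rangeSum f u ≠ ⊤ :=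
  ne_top_of_le_ne_top (normI_ne_top f) (rangeSum_le_normI f u)

variable {D : InvariantSet G}

/-- By invariance of `D`, the whole fibre of `G` over a unit in `D` lies in `G|_D`. -/
lemma sourceSum_restrictHom (hD : IsClosed D.carrier) (f : Cc G) (d : UnitSpace (Restrict D)) :
    sourceSum (restrictHom D hD f) d = sourceSum f (Restrict.unit d) :=
  (Restrict.fiberEquiv d).tsum_eq fun γ => ‖f γ.1‖ₑ

lemma rangeSum_restrictHom (hD : IsClosed D.carrier) (f : Cc G) (d : UnitSpace (Restrict D)) :
    rangeSum (restrictHom D hD f) d = rangeSum f (Restrict.unit d) :=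
  (Restrict.rangeFiberEquiv d).tsum_eq fun γ => ‖f γ.1‖ₑ

lemma normI_restrictHom_le (hD : IsClosed D.carrier) (f : Cc G) :
    normI (restrictHom D hD f) ≤ normI f :=
  (normI_le_iff _ _).2 fun d => by
    rw [sourceSum_restrictHom, rangeSum_restrictHom]
    exact ⟨sourceSum_le_normI f _, rangeSum_le_normI f _⟩

/-- A function on `G` can be damped off
`D` so that its `I`-norm is that of its restriction to `G|_D`. -/
lemma exists_normI_le_normI_restrictHom (hD : IsClosed D.carrier) (f : Cc G) :
    ∃ f' : Cc G, restrictHom D hD f' = restrictHom D hD f ∧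
      normI f' ≤ normI (restrictHom D hD f) := by
  set g := restrictHom D hD f with hg
  -- Set apart because the damping factor below divides by a quantity that is positive only if
  -- `normI g` is.
  by_cases h0 : normI g = 0
  · refine ⟨0, ?_, ?_⟩
    · rw [map_zero, eq_zero_of_normI_eq_zero g h0]
    · exact (normI_le_iff _ _).2 fun u => by simp [sourceSum, rangeSum]
  let M : ℝ := (normI g).toReal
  have hM : 0 < M := ENNReal.toReal_pos h0 (normI_ne_top g)
  have hMg : ENNReal.ofReal M = normI g := ENNReal.ofReal_toReal (normI_ne_top g)
  let m : UnitSpace G → ℝ := fun u => max M (max (sourceSum f u).toReal (rangeSum f u).toReal)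
  have hm : ∀ u, M ≤ m u := fun u => le_max_left _ _
  have hmc : Continuous m := by
    refine continuous_const.max (Continuous.max ?_ ?_)
    · exact ENNReal.continuousOn_toReal.comp_continuous (continuous_sourceSum f)
        (sourceSum_ne_top f)
    · exact ENNReal.continuousOn_toReal.comp_continuous (continuous_rangeSum f)
        (rangeSum_ne_top f)
  -- At each unit `χ` shrinks both fibre sums of `f` to at most `M`. On `D` these sums are at most
  -- `M` already, so there `χ = 1` and `f` is unchanged.
  let χ : UnitSpace G → ℝ := fun u => M / m u
  have hχc : Continuous χ := continuous_const.div hmc fun u => (hM.trans_le (hm u)).ne'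
  have hχ0 : ∀ u, 0 ≤ χ u := fun u => div_nonneg hM.le (hM.le.trans (hm u))
  have hχ1 : ∀ u, χ u ≤ 1 := fun u => (div_le_one (hM.trans_le (hm u))).2 (hm u)
  have hχm : ∀ u, ENNReal.ofReal (χ u) * ENNReal.ofReal (m u) = normI g := by
    intro u
    rw [← ENNReal.ofReal_mul (hχ0 u), div_mul_cancel₀ _ (hM.trans_le (hm u)).ne', hMg]
  have hχD : ∀ u ∈ D.carrier, χ u = 1 := by
    intro u hu
    have h1 : m u = M := by
      refine max_eq_left (max_le ?_ ?_)
      · have h := sourceSum_le_normI g (Restrict.ofUnit u hu)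
        rw [hg, sourceSum_restrictHom] at h
        exact ENNReal.toReal_mono (normI_ne_top g) h
      · have h := rangeSum_le_normI g (Restrict.ofUnit u hu)
        rw [hg, rangeSum_restrictHom] at h
        exact ENNReal.toReal_mono (normI_ne_top g) h
    simp only [χ, h1, div_self hM.ne']
  -- The factor at the source controls source sums and the factor at the range controls range sums;
  -- in each case the other factor is at most `1`.
  let f' : Cc G := Cc.mk (fun γ => f γ * ((χ (sourceMap γ) * χ (rangeMap γ) : ℝ) : ℂ))
    (f.continuous.mul (Complex.continuous_ofReal.comp
      ((hχc.comp continuous_source).mul (hχc.comp continuous_range))))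
    f.hasCompactSupport.mul_right
  have henorm : ∀ t : ℝ, 0 ≤ t → ‖(t : ℂ)‖ₑ = ENNReal.ofReal t := fun t ht => by
    rw [← ofReal_norm, Complex.norm_real, Real.norm_of_nonneg ht]
  have hf' : ∀ γ, ‖f' γ‖ₑ =
      ‖f γ‖ₑ * (ENNReal.ofReal (χ (sourceMap γ)) * ENNReal.ofReal (χ (rangeMap γ))) := by
    intro γ
    simp only [f', Cc.mk_apply]
    rw [enorm_mul, henorm _ (mul_nonneg (hχ0 _) (hχ0 _)), ENNReal.ofReal_mul (hχ0 _)]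
  have hone : ∀ u, ENNReal.ofReal (χ u) ≤ 1 := fun u => by simpa using hχ1 u
  refine ⟨f', ?_, (normI_le_iff _ _).2 fun u => ⟨?_, ?_⟩⟩
  · ext γ
    change f γ.1 * ((χ (sourceMap γ.1) * χ (rangeMap γ.1) : ℝ) : ℂ) = f γ.1
    rw [hχD _ γ.2.1, hχD _ γ.2.2]
    simp
  · calc sourceSum f' u ≤ ∑' γ : {γ : G // sourceMap γ = u}, ENNReal.ofReal (χ u) * ‖f γ.1‖ₑ := by
          refine ENNReal.tsum_le_tsum fun γ => ?_
          rw [hf', γ.2, mul_comm]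
          gcongr
          exact mul_le_of_le_one_right' (hone _)
      _ = ENNReal.ofReal (χ u) * sourceSum f u := ENNReal.tsum_mul_left
      _ ≤ ENNReal.ofReal (χ u) * ENNReal.ofReal (m u) := by
          gcongr
          rw [← ENNReal.ofReal_toReal (sourceSum_ne_top f u)]
          exact ENNReal.ofReal_le_ofReal ((le_max_left _ _).trans (le_max_right _ _))
      _ = _ := hχm u
  · calc rangeSum f' u ≤ ∑' γ : {γ : G // rangeMap γ = u}, ENNReal.ofReal (χ u) * ‖f γ.1‖ₑ := by
          refine ENNReal.tsum_le_tsum fun γ => ?_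
          rw [hf', γ.2, mul_comm]
          gcongr
          exact mul_le_of_le_one_left' (hone _)
      _ = ENNReal.ofReal (χ u) * rangeSum f u := ENNReal.tsum_mul_left
      _ ≤ ENNReal.ofReal (χ u) * ENNReal.ofReal (m u) := by
          gcongr
          rw [← ENNReal.ofReal_toReal (rangeSum_ne_top f u)]
          exact ENNReal.ofReal_le_ofReal ((le_max_right _ _).trans (le_max_right _ _))
      _ = _ := hχm u

variable [LocallyCompactSpace G]

/-- A compactly supported function that is `1` on a given compact set. -/
lemma exists_cc_eq_one {K : Set G} (hK : IsCompact K) : ∃ k : Cc G, ∀ γ ∈ K, k γ = 1 := by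
  obtain ⟨k, hk1, -, hks, -⟩ := exists_continuous_one_zero_of_isCompact hK isClosed_empty
    (disjoint_empty K)
  refine ⟨Cc.mk (fun γ => (k γ : ℂ)) (Complex.continuous_ofReal.comp k.continuous)
    (hks.comp_left (g := fun t : ℝ => (t : ℂ)) Complex.ofReal_zero), fun γ hγ => ?_⟩
  simp [hk1 hγ]

/-- Tietze extension from the closed subset `G|_D` of the normal space `G`, followed by a compactly
supported cutoff equal to `1` on the support of `g`. -/
lemma restrictHom_surjective [SecondCountableTopology G] (hD : IsClosed D.carrier) :
    Function.Surjective (restrictHom D hD) := by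
  intro g
  obtain ⟨F, hF⟩ := ContinuousMap.exists_extension' (isClosedEmbedding_val D hD)
    (⟨g, g.continuous⟩ : C(Restrict D, ℂ))
  obtain ⟨k, hk⟩ := exists_cc_eq_one (g.hasCompactSupport.isCompact.image Restrict.continuous_val)
  refine ⟨Cc.mk (fun γ => F γ * k γ) (F.continuous.mul k.continuous) k.hasCompactSupport.mul_left,
    ?_⟩
  ext γ
  have hFg : F γ.1 = g γ := congrFun hF γ
  change F γ.1 * k γ.1 = g γ
  rw [hFg]
  by_cases hγ : γ ∈ tsupport g
  · rw [hk _ ⟨γ, hγ, rfl⟩, mul_one]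
  · rw [g.eq_zero_of_notMem hγ, zero_mul]

/-- Functions vanishing on `G|_D` are approximated by functions supported in the complement. -/
lemma exists_normI_sub_extend_le (hD : IsClosed D.carrier) (f : Cc G)
    (hf : restrictHom D hD f = 0) {ε : ℝ} (hε : 0 < ε) :
    ∃ h : Cc (Restrict D.compl),
      (normI (f - extendZeroHom D.compl (isOpen_compl_carrier hD) h)).toReal ≤ ε := by
  obtain ⟨k, hk⟩ := exists_cc_eq_one f.hasCompactSupport.isCompact
  -- Chosen so that `δ * normI k ≤ ε`; the `+ 1` keeps the denominator positive.
  let δ : ℝ := ε / ((normI k).toReal + 1)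
  have hk0 : 0 ≤ (normI k).toReal := ENNReal.toReal_nonneg
  have hδ : 0 < δ := by positivity
  -- Soft thresholding: it moves no point by more than `δ` and vanishes on the disc of radius `δ`.
  -- The maximum in the denominator matters only inside that disc, where it avoids division by zero.
  let φ : ℂ → ℂ := fun z => z * ((max (‖z‖ - δ) 0 / max ‖z‖ δ : ℝ) : ℂ)
  have hmax : ∀ z : ℂ, 0 < max ‖z‖ δ := fun z => lt_max_of_lt_right hδ
  have hφc : Continuous φ := continuous_id.mul (Complex.continuous_ofReal.comp
    (((continuous_norm.sub continuous_const).max continuous_const).div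
      (continuous_norm.max continuous_const) fun z => (hmax z).ne'))
  have hφ0 : ∀ z, ‖z‖ ≤ δ → φ z = 0 := by
    intro z hz
    simp [φ, max_eq_right (sub_nonpos.2 hz)]
  have hφz : φ 0 = 0 := by simp [φ]
  have hφd : ∀ z, ‖z - φ z‖ ≤ δ := by
    intro z
    rcases le_total ‖z‖ δ with hz | hz
    · rwa [hφ0 z hz, sub_zero]
    · have hz0 : 0 < ‖z‖ := hδ.trans_le hz
      have h1 : z - φ z = z * ((δ / ‖z‖ : ℝ) : ℂ) := by
        simp only [φ, max_eq_left (sub_nonneg.2 hz), max_eq_left hz]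
        rw [sub_div, div_self hz0.ne']
        push_cast
        ring
      rw [h1, norm_mul, Complex.norm_real, Real.norm_of_nonneg (by positivity),
        mul_div_cancel₀ _ hz0.ne']
  -- `φ ∘ f` vanishes off this compact set. Because `f` is zero on `G|_D`, the set is disjoint from
  -- `G|_D`, hence compact inside the restriction to the complement.
  let K : Set G := tsupport f ∩ {γ | δ ≤ ‖f γ‖}
  have hK : IsCompact K := f.hasCompactSupport.isCompact.inter_right
    (isClosed_le continuous_const f.continuous.norm)
  have hKD : ∀ γ ∈ K, sourceMap γ ∉ D.carrier := by
    intro γ hγ hs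
    have h1 : f γ = 0 := DFunLike.congr_fun hf (⟨γ, D.range_mem γ hs, hs⟩ : Restrict D)
    have h2 : δ ≤ ‖f γ‖ := hγ.2
    rw [h1, norm_zero] at h2
    linarith
  have hKr : IsCompact ((Subtype.val : Restrict D.compl → G) ⁻¹' K) := by
    refine (Topology.IsInducing.subtypeVal).isCompact_preimage' hK ?_
    intro γ hγ
    exact ⟨⟨γ, D.compl.range_mem γ (hKD γ hγ), hKD γ hγ⟩, rfl⟩
  let h : Cc (Restrict D.compl) := Cc.mk (fun γ => φ (f γ.1))
    (hφc.comp (f.continuous.comp Restrict.continuous_val))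
    (HasCompactSupport.intro hKr fun γ hγ => by
      by_cases h1 : γ.1 ∈ tsupport f
      · refine hφ0 _ (le_of_lt ?_)
        by_contra! h2
        exact hγ ⟨h1, h2⟩
      · rw [f.eq_zero_of_notMem h1, hφz])
  have hext : ∀ γ, extendZeroHom D.compl (isOpen_compl_carrier hD) h γ = φ (f γ) := by
    intro γ
    change Function.extend (Subtype.val : Restrict D.compl → G) h 0 γ = φ (f γ)
    by_cases hs : sourceMap γ ∈ D.carrier
    · have h1 : f γ = 0 := DFunLike.congr_fun hf (⟨γ, D.range_mem γ hs, hs⟩ : Restrict D)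
      rw [extend_eq_zero D.compl h γ (fun h => h hs), h1, hφz]
    · rw [extend_eq D.compl h γ ⟨D.compl.range_mem γ hs, hs⟩]
      rfl
  refine ⟨h, ?_⟩
  have hle : normI (f - extendZeroHom D.compl (isOpen_compl_carrier hD) h) ≤ ENNReal.ofReal δ * normI k := by
    refine normI_le_mul _ _ _ fun γ => ?_
    change ‖f γ - extendZeroHom D.compl (isOpen_compl_carrier hD) h γ‖ₑ ≤ _
    rw [hext]
    by_cases h1 : γ ∈ tsupport f
    · rw [hk γ h1, enorm_one, mul_one, ← ofReal_norm]
      exact ENNReal.ofReal_le_ofReal (hφd _)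
    · rw [f.eq_zero_of_notMem h1, hφz, sub_zero, enorm_zero]
      exact zero_le
  calc _ ≤ (ENNReal.ofReal δ * normI k).toReal := ENNReal.toReal_mono
          (ENNReal.mul_ne_top ENNReal.ofReal_ne_top (normI_ne_top k)) hle
    _ = δ * (normI k).toReal := by rw [ENNReal.toReal_mul, ENNReal.toReal_ofReal hδ.le]
    _ ≤ ε := by
      rw [div_mul_eq_mul_div, div_le_iff₀ (by positivity)]
      gcongr
      linarith

end RestrictionOfFunctions

/-! ### Isometry on dense subsets and coordinates of bounded products -/

section CStarHomomorphisms

variable {B C : Type*} [NonUnitalCStarAlgebra B] [NonUnitalCStarAlgebra C]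

/-- A `*`-homomorphism of `C*`-algebras that is isometric on a dense subset is injective. -/
lemma injective_of_norm_eq_on_dense {E : Type*} {j : E → B} (hj : DenseRange j) (φ : B →⋆ₙₐ[ℂ] C)
    (h : ∀ a, ‖φ (j a)‖ = ‖j a‖) : Function.Injective φ := by
  have hn : ∀ x, ‖φ x‖ = ‖x‖ := fun x =>
    hj.induction_on (p := fun x => ‖φ x‖ = ‖x‖) x (isClosed_eq (continuous_starHom φ).norm continuous_norm) h
  exact (injective_iff_map_eq_zero φ).2 fun x hx => by rw [← norm_eq_zero, ← hn, hx, norm_zero]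

/-- Evaluation of an element of a bounded product at an index. -/
def evalBoundedProduct {I : Type*} (D : I → Type*) [∀ i, NonUnitalCStarAlgebra (D i)] (i : I) :
    BoundedProduct D →⋆ₙₐ[ℂ] D i where
  toFun a := (show lp D ∞ from a) i
  map_smul' _ _ := rfl
  map_zero' := rfl
  map_add' _ _ := rfl
  map_mul' _ _ := rfl
  map_star' _ := rfl

end CStarHomomorphisms

/-! ### The reduced sequence and the comparison of full and reduced norms -/

section GroupoidAlgebras

variable {G : Type u} [TopologicalSpace G] [ArrowGroupoid G] [EtaleGroupoid G] [T2Space G]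

lemma denseRange_toFull : DenseRange (toFull G) := denseRange_toClosureRange _

lemma denseRange_toReduced : DenseRange (toReduced G) := denseRange_toClosureRange _

lemma norm_toReduced (f : Cc G) : ‖toReduced G f‖ = ‖reducedRep G f‖ := rfl

lemma Representation.norm_le_fullRep (π : Representation G) (f : Cc G) :
    ‖π.toHom f‖ ≤ ‖fullRep G f‖ :=
  le_norm_directSumHom (fun π : Representation G => π.toHom) (fun f => (normI f).toReal)
    (fun π f => π.norm_le f) f π

lemma norm_toReduced_le_normI (f : Cc G) : ‖toReduced G f‖ ≤ (normI f).toReal :=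
  norm_directSumHom_le (fun u : UnitSpace G => regularRep u) (fun f => (normI f).toReal)
    (fun u f => regularOperator_norm_le u f) f ENNReal.toReal_nonneg
    fun u => regularOperator_norm_le u f

/-- `C*(G) = C*_r(G)` holds when the full norm is dominated by the reduced norm. -/
lemma fullEqReduced_iff :
    FullEqReduced G ↔ ∀ f : Cc G, ‖fullRep G f‖ ≤ ‖reducedRep G f‖ := by
  constructor
  · intro h f
    have h1 := NonUnitalStarAlgHom.norm_map (fullToReduced G) h.1 (toFull G f)
    rw [fullToReduced_toFull] at h1
    exact h1.ge
  · intro h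
    have hn : ∀ f, ‖fullToReduced G (toFull G f)‖ = ‖toFull G f‖ := fun f => by
      rw [fullToReduced_toFull]
      exact le_antisymm (norm_toReduced_le G f) (h f)
    refine ⟨injective_of_norm_eq_on_dense denseRange_toFull _ hn,
      surjective_of_denseRange _ (denseRange_toReduced.mono ?_)⟩
    rintro _ ⟨f, rfl⟩
    exact ⟨toFull G f, fullToReduced_toFull G f⟩

variable (G) in
/-- The regular representation `π_u` extended to `C*_r(G)`. -/
noncomputable def reducedRegularRep (u : UnitSpace G) :
    ReducedCStar G →⋆ₙₐ[ℂ] (FiberSpace u →L[ℂ] FiberSpace u) :=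
  (evalBoundedProduct (fun u : UnitSpace G => (FiberSpace u →L[ℂ] FiberSpace u)) u).comp
    (NonUnitalStarSubalgebraClass.subtype (closureRange (reducedRep G)))

/-- The norm of `C*_r(G)` is a supremum over units, so the regular representations form a norming
family as `exists_representation_of_notMem_ideal` requires. -/
lemma exists_lt_norm_reducedRegularRep (a : ReducedCStar G) (r : ℝ) (h : r < ‖a‖) (hr : 0 ≤ r) :
    ∃ u, r < ‖reducedRegularRep G u a‖ := by
  by_contra! hcon
  exact h.not_ge (Real.iSup_le hcon hr)

variable {D : InvariantSet G}

/-- The regular representation of `G|_D` at a unit is unitarily equivalent to that of `G` at the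
same unit, evaluated on the extension by zero. Hence extension by zero preserves the reduced norm.
-/
lemma iotaReduced_injective (hD : IsOpen D.carrier) : Function.Injective (iotaReduced D hD) := by
  refine injective_of_norm_eq_on_dense denseRange_toReduced _ fun f => ?_
  refine le_antisymm (NonUnitalStarAlgHom.norm_apply_le _ _) ?_
  rw [iotaReduced_toReduced]
  refine norm_directSumHom_le (fun d : UnitSpace (Restrict D) => regularRep d)
    (fun f => (normI f).toReal) (fun d f => regularOperator_norm_le d f) f (norm_nonneg _)
    fun d => ?_
  change ‖regularOperator d f‖ ≤ _
  rw [regularOperator_extend_of_mem D hD f d, Restrict.norm_operatorEquiv]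
  exact le_norm_directSumHom (fun u : UnitSpace G => regularRep u)
    (fun f => (normI f).toReal) (fun u f => regularOperator_norm_le u f)
    (extendFun D hD f) (Restrict.unit d)

lemma isClosed_range_iotaReduced (hD : IsOpen D.carrier) : IsClosed (range (iotaReduced D hD)) :=
  (NonUnitalStarAlgHom.isometry _ (iotaReduced_injective hD)).isClosedEmbedding.isClosed_range

lemma restrictHom_extendZeroHom (hD : IsClosed D.carrier) (h : Cc (Restrict D.compl)) :
    restrictHom D hD (extendZeroHom D.compl (isOpen_compl_carrier hD) h) = 0 := by
  ext γ
  exact extend_eq_zero D.compl h γ.1 fun hs => hs γ.2.2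

lemma rhoReduced_iotaReduced (hD : IsClosed D.carrier) (a : ReducedCStar (Restrict D.compl)) :
    rhoReduced D hD (iotaReduced D.compl (isOpen_compl_carrier hD) a) = 0 := by
  refine denseRange_toReduced.induction_on
    (p := fun a => rhoReduced D hD (iotaReduced D.compl (isOpen_compl_carrier hD) a) = 0) a
    (isClosed_eq ((continuous_starHom _).comp (continuous_starHom _)) continuous_const) fun h => ?_
  rw [iotaReduced_toReduced, rhoReduced_toReduced, restrictHom_extendZeroHom, map_zero]

variable [LocallyCompactSpace G]

/-- Exactness in the middle at the level of functions: the `I`-norm approximation passes to the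
reduced norm, and the range of `ι_r` is closed. -/
lemma toReduced_mem_range_iotaReduced (hD : IsClosed D.carrier) (f : Cc G)
    (hf : restrictHom D hD f = 0) :
    toReduced G f ∈ range (iotaReduced D.compl (isOpen_compl_carrier hD)) := by
  rw [← (isClosed_range_iotaReduced (isOpen_compl_carrier hD)).closure_eq, Metric.mem_closure_iff]
  intro ε hε
  obtain ⟨h, hh⟩ := exists_normI_sub_extend_le hD f hf (half_pos hε)
  refine ⟨_, ⟨toReduced _ h, rfl⟩, ?_⟩
  rw [iotaReduced_toReduced, dist_eq_norm, ← map_sub]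
  exact ((norm_toReduced_le_normI _).trans hh).trans_lt (half_lt_self hε)

/-- On functions, restriction to `G|_D` is multiplicative, so a product with a factor vanishing
there vanishes there. Closedness of the range carries this to limits in each variable. -/
lemma mul_iotaReduced_mem_range (hD : IsClosed D.carrier) (a : ReducedCStar G)
    (b : ReducedCStar (Restrict D.compl)) :
    a * iotaReduced D.compl (isOpen_compl_carrier hD) b ∈ range (iotaReduced D.compl (isOpen_compl_carrier hD)) := by
  have hι := continuous_starHom (iotaReduced D.compl (isOpen_compl_carrier hD))
  refine denseRange_toReduced.induction_on (p := fun a =>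
    a * iotaReduced D.compl (isOpen_compl_carrier hD) b ∈ range (iotaReduced D.compl (isOpen_compl_carrier hD))) a
    ((isClosed_range_iotaReduced (isOpen_compl_carrier hD)).preimage (by fun_prop)) fun f => ?_
  refine denseRange_toReduced.induction_on (p := fun b => toReduced G f *
    iotaReduced D.compl (isOpen_compl_carrier hD) b ∈ range (iotaReduced D.compl (isOpen_compl_carrier hD))) b
    ((isClosed_range_iotaReduced (isOpen_compl_carrier hD)).preimage (by fun_prop)) fun h => ?_
  rw [iotaReduced_toReduced, ← map_mul]
  refine toReduced_mem_range_iotaReduced hD _ ?_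
  rw [map_mul, restrictHom_extendZeroHom, mul_zero]

variable [SecondCountableTopology G]

/-- The range contains all of `C_c(G|_D)`, hence is dense, and a dense range is everything for
`C*`-algebras. -/
lemma rhoReduced_surjective (hD : IsClosed D.carrier) :
    Function.Surjective (rhoReduced D hD) := by
  refine surjective_of_denseRange _ (denseRange_toReduced.mono ?_)
  rintro _ ⟨g, rfl⟩
  obtain ⟨f, rfl⟩ := restrictHom_surjective hD g
  exact ⟨toReduced G f, rhoReduced_toReduced D hD f⟩

/-- A representation of `C*_r(G)` that vanishes on the functions supported off `D` comes from an
`I`-norm decreasing representation of `C_c(G|_D)`. -/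
lemma exists_representation_restrict (hD : IsClosed D.carrier) {H : Type u}
    [NormedAddCommGroup H] [InnerProductSpace ℂ H] [CompleteSpace H]
    (π : ReducedCStar G →⋆ₙₐ[ℂ] (H →L[ℂ] H))
    (hπ : ∀ b, π (iotaReduced D.compl (isOpen_compl_carrier hD) b) = 0) :
    ∃ σ : Representation (Restrict D), ∀ f, ‖σ.toHom (restrictHom D hD f)‖ = ‖π (toReduced G f)‖ := by
  have hlift : ∀ g : Cc (Restrict D), ∃ f : Cc G, restrictHom D hD f = g ∧ normI f ≤ normI g := by
    intro g
    obtain ⟨f, rfl⟩ := restrictHom_surjective hD g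
    exact exists_normI_le_normI_restrictHom hD f
  -- `L` is a mere choice of lifts and need not be linear; `hp` shows that `p` depends only on the
  -- restriction, so `p ∘ L` is still a `*`-homomorphism. The bound `hLn` is what makes it `I`-norm
  -- decreasing.
  choose L hL hLn using hlift
  let p : Cc G →⋆ₙₐ[ℂ] (H →L[ℂ] H) := π.comp (toReduced G)
  have hp : ∀ f f', restrictHom D hD f = restrictHom D hD f' → p f = p f' := by
    intro f f' h
    obtain ⟨b, hb⟩ := toReduced_mem_range_iotaReduced hD (f - f') (by rw [map_sub, h, sub_self])
    rw [← sub_eq_zero, ← map_sub]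
    change π (toReduced G (f - f')) = 0
    rw [← hb, hπ]
  let s : Cc (Restrict D) →⋆ₙₐ[ℂ] (H →L[ℂ] H) :=
    { toFun := fun g => p (L g)
      map_smul' := fun c g => by
        rw [hp (L (c • g)) (c • L g) (by rw [hL, map_smul, hL]), map_smul]
        rfl
      map_zero' := by rw [hp (L 0) 0 (by rw [hL, map_zero]), map_zero]
      map_add' := fun g g' => by
        rw [hp (L (g + g')) (L g + L g') (by rw [hL, map_add, hL, hL]), map_add]
      map_mul' := fun g g' => by
        rw [hp (L (g * g')) (L g * L g') (by rw [hL, map_mul, hL, hL]), map_mul]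
      map_star' := fun g => by
        rw [hp (L (star g)) (star (L g)) (by rw [hL, map_star, hL]), map_star] }
  refine ⟨{ H := H, toHom := s, enorm_le := fun g => ?_ }, fun f => ?_⟩
  · have h1 : ‖p (L g)‖ ≤ (normI (L g)).toReal :=
      (NonUnitalStarAlgHom.norm_apply_le π _).trans (norm_toReduced_le_normI _)
    change ‖p (L g)‖ₑ ≤ _
    rw [← ofReal_norm]
    refine (ENNReal.ofReal_le_ofReal h1).trans ?_
    rw [ENNReal.ofReal_toReal (normI_ne_top _)]
    exact hLn g
  · change ‖p (L (restrictHom D hD f))‖ = ‖p f‖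
    rw [hp _ f (hL _)]

/-- If the full and the reduced `C*`-algebra of `G|_D` agree, then the kernel of `ρ_r` is the range
of `ι_r`. -/
lemma mem_range_iotaReduced_of_rhoReduced_eq_zero (hD : IsClosed D.carrier)
    (h : FullEqReduced (Restrict D)) (x : ReducedCStar G) (hx : rhoReduced D hD x = 0) :
    x ∈ range (iotaReduced D.compl (isOpen_compl_carrier hD)) := by
  by_contra hmem
  obtain ⟨H, _, _, _, π, hπ, hπx⟩ := exists_representation_of_notMem_ideal (reducedRegularRep G)
    exists_lt_norm_reducedRegularRep (iotaReduced D.compl (isOpen_compl_carrier hD))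
    (iotaReduced_injective _) (mul_iotaReduced_mem_range hD) x hmem
  obtain ⟨σ, hσ⟩ := exists_representation_restrict hD π hπ
  -- On functions, `‖π f‖ = ‖σ (f|_D)‖` is at most the full norm of `f|_D`, which by hypothesis is
  -- bounded by the reduced norm; density gives the rest.
  have hle : ‖π x‖ ≤ ‖rhoReduced D hD x‖ := by
    refine denseRange_toReduced.induction_on (p := fun x => ‖π x‖ ≤ ‖rhoReduced D hD x‖) x
      (isClosed_le (continuous_starHom _).norm (continuous_starHom _).norm) fun f => ?_
    rw [← hσ, rhoReduced_toReduced]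
    exact (σ.norm_le_fullRep _).trans (fullEqReduced_iff.1 h _)
  rw [hx, norm_zero] at hle
  exact hπx (norm_le_zero_iff.1 hle)

/-- Exactness at `C*_r(G)` passes the equality of full and reduced norms from `G` to `G|_D`. -/
lemma fullEqReduced_restrict (hG : FullEqReduced G) (hD : IsClosed D.carrier)
    (h : Function.Exact (iotaReduced D.compl (isOpen_compl_carrier hD)) (rhoReduced D hD)) :
    FullEqReduced (Restrict D) := by
  refine fullEqReduced_iff.2 fun g => ?_
  refine norm_directSumHom_le (fun σ : Representation (Restrict D) => σ.toHom)
    (fun f => (normI f).toReal) (fun σ f => σ.norm_le f) g (norm_nonneg _) fun σ => ?_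
  let τ : Representation G :=
    { H := σ.H
      toHom := σ.toHom.comp (restrictHom D hD)
      enorm_le := fun f => (σ.enorm_le _).trans (normI_restrictHom_le hD f) }
  -- Equality of the full and reduced norms of `G` lets a representation defined on functions extend
  -- to `C*_r(G)`, where exactness can be applied.
  have hτ : ∀ f, ‖τ.toHom f‖ ≤ ‖reducedRep G f‖ := fun f =>
    (τ.norm_le_fullRep f).trans (fullEqReduced_iff.1 hG f)
  let T : ReducedCStar G →⋆ₙₐ[ℂ] (σ.H →L[ℂ] σ.H) := extendHom (reducedRep G) τ.toHom hτ
  have hT : ∀ f, T (toReduced G f) = σ.toHom (restrictHom D hD f) := extendHom_apply _ _ _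
  have hTι : ∀ b, T (iotaReduced D.compl (isOpen_compl_carrier hD) b) = 0 := by
    intro b
    refine denseRange_toReduced.induction_on
      (p := fun b => T (iotaReduced D.compl (isOpen_compl_carrier hD) b) = 0) b
      (isClosed_eq ((continuous_starHom _).comp (continuous_starHom _)) continuous_const)
      fun f => ?_
    rw [iotaReduced_toReduced, hT, restrictHom_extendZeroHom, map_zero]
  obtain ⟨f, rfl⟩ := restrictHom_surjective hD g
  rw [← hT, ← norm_toReduced, ← rhoReduced_toReduced]
  -- Exactness identifies the kernel of `ρ_r` with the range of `ι_r`, on which `T` is zero by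
  -- `hTι`.
  refine norm_le_of_ker_le (rhoReduced D hD) T (fun a ha => ?_) _
  obtain ⟨b, rfl⟩ := (h a).1 ha
  exact hTι b

end GroupoidAlgebras

end GroupoidCStar

theorem lemma6p1 {G : Type*} [TopologicalSpace G] [GroupoidCStar.ArrowGroupoid G]
    [GroupoidCStar.EtaleGroupoid G] [SecondCountableTopology G] [LocallyCompactSpace G]
    [T2Space G] (hG : GroupoidCStar.FullEqReduced G) :
    (∀ D : GroupoidCStar.InvariantSet G, IsClosed D.carrier →
      GroupoidCStar.FullEqReduced (GroupoidCStar.Restrict D)) ↔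
    (∀ (D : GroupoidCStar.InvariantSet G) (hD : IsClosed D.carrier),
      GroupoidCStar.ReducedSequenceExact D hD) := by
  constructor
  · intro h D hD
    refine ⟨GroupoidCStar.iotaReduced_injective _, fun x => ⟨fun hx =>
      GroupoidCStar.mem_range_iotaReduced_of_rhoReduced_eq_zero hD (h D hD) x hx, ?_⟩,
      GroupoidCStar.rhoReduced_surjective hD⟩
    rintro ⟨b, rfl⟩
    exact GroupoidCStar.rhoReduced_iotaReduced hD b
  · intro h D hD
    exact GroupoidCStar.fullEqReduced_restrict hG hD (h D hD).2.1
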